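/- Let $n\ge 1$ be an integer and let $c\in\mathbb R$. (a) Let $f\in L^2(\mathbb R^n)$ and let $u\in C(\mathbb R;L^2(\mathbb R^n))$ be the solution of the damped Schrödinger initial value problem $$i\,\partial_t u(t,x)+(\Delta-c)\,u(t,x)=0,\qquad u(0,\cdot)=f,$$ where the equation is understood in the sense of distributions on $\mathbb R\times\mathbb R^n$. If there is $t_0>0$ such that $$\int_{\mathbb R^n}\int_{\mathbb R^n}|f(x)|\,|u(t_0,y)|\,e^{\frac{|x|\,|y|}{2t_0}}\,dx\,dy<\infty, \qquad (*)$$ then $f=0$, and hence $u(t,\cdot)=0$ for all $t\in\mathbb R$. (b) Let $f\in L^1(\mathbb R^n)$ and let $(u_t)_{t\in\mathbb R}$ be tempered distributions on $\mathbb R^n$ with $$\widehat{u_t}(\lambda)=e^{-i(|\lambda|^2+c)t}\,\widehat f(\lambda)\quad\text{in }\mathcal S'(\mathbb R^n)\text{ for all }t\in\mathbb R,$$ where $\widehat{\ }$ is the Fourier transform on $\mathcal S'(\mathbb R^n)$ extending $\widehat h(\lambda)=(2\pi)^{-n/2}\int_{\mathbb R^n}h(x)e^{-i\langle x,\lambda\rangle}\,dx$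 (equivalently, with $\mathcal F h(\xi)=\int_{\mathbb R^n} h(x)e^{-2\pi i\langle x,\xi\rangle}\,dx$: $\mathcal F u_t(\xi)=e^{-i(4\pi^2|\xi|^2+c)t}\mathcal F f(\xi)$). If there is $t_0>0$ such that $u_{t_0}$ is given by a locally integrable function $u(t_0,\cdot)$ for which $(*)$ holds, then $f=0$, and hence $u_t=0$ for all $t\in\mathbb R$. -/

import Mathlib

open MeasureTheory SchwartzMap FourierTransform Laplacian
open scoped ContDiff

/-- `u ∈ C(ℝ; L²(ℝⁿ))` is the solution of the damped Schrödinger initial value problem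
`i ∂ₜ u + (Δ - c) u = 0`, `u(0, ·) = f`: it is continuous in time with values in `L²`, takes the
value `f` at `t = 0`, and satisfies the equation in the sense of distributions on `ℝ × ℝⁿ`, i.e.
`∬ u (-i ∂ₜ φ + Δφ - c φ) dx dt = 0` for all smooth compactly supported `φ`. -/
structure IsDampedSchrodingerSolution {n : ℕ} (c : ℝ)
    (f : Lp ℂ 2 (volume : Measure (EuclideanSpace ℝ (Fin n))))
    (u : ℝ → Lp ℂ 2 (volume : Measure (EuclideanSpace ℝ (Fin n)))) : Prop where
  continuous : Continuous u
  initial : u 0 = f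
  equation : ∀ φ : ℝ × EuclideanSpace ℝ (Fin n) → ℂ, ContDiff ℝ ∞ φ → HasCompactSupport φ →
    ∫ t : ℝ, ∫ x : EuclideanSpace ℝ (Fin n),
      u t x * (-Complex.I * deriv (fun s => φ (s, x)) t
        + Δ (fun y => φ (t, y)) x - c * φ (t, x)) = 0

/-- The multiplier `e^{-i(|λ|² + c)t}`, written in the frequency variable `ξ = λ / (2π)` that
belongs to the normalisation `𝓕 f (ξ) = ∫ e^{-2πi⟨x, ξ⟩} f(x) dx` of the Fourier transform. -/
noncomputable def dampedSchrodingerSymbol (n : ℕ) (c t : ℝ) (ξ : EuclideanSpace ℝ (Fin n)) : ℂ :=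
  Complex.exp (-Complex.I * ((((2 * Real.pi * ‖ξ‖) ^ 2 + c) * t : ℝ) : ℂ))

/-- The oscillating exponential has temperate growth. -/
theorem hasTemperateGrowth_cexp_neg_I_mul :
    Function.HasTemperateGrowth (fun s : ℝ => Complex.exp (-Complex.I * (s : ℂ))) := by
  have hd : ∀ s : ℝ, HasDerivAt (fun s : ℝ => Complex.exp (-Complex.I * (s : ℂ)))
      (-Complex.I * Complex.exp (-Complex.I * (s : ℂ))) s := by
    intro s
    have h1 : HasDerivAt (fun s : ℝ => -Complex.I * (s : ℂ)) (-Complex.I) s := by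
      simpa using (Complex.ofRealCLM.hasDerivAt (x := s)).const_mul (-Complex.I)
    simpa [mul_comm] using h1.cexp
  have hi : ∀ k : ℕ, iteratedDeriv k (fun s : ℝ => Complex.exp (-Complex.I * (s : ℂ)))
      = fun s : ℝ => (-Complex.I) ^ k * Complex.exp (-Complex.I * (s : ℂ)) := by
    intro k
    induction k with
    | zero => simp
    | succ k ih =>
      rw [iteratedDeriv_succ, ih]
      funext s
      rw [((hd s).const_mul ((-Complex.I) ^ k)).deriv, pow_succ, mul_assoc]
  refine ⟨?_, fun k => ⟨0, 1, fun s => ?_⟩⟩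
  · have h : ContDiff ℝ ∞ (fun s : ℝ => (s : ℂ)) := Complex.ofRealCLM.contDiff
    exact (contDiff_const.mul h).cexp
  · rw [norm_iteratedFDeriv_eq_norm_iteratedDeriv, hi]
    simp [Complex.norm_exp]

/-- The multiplier has temperate growth, so multiplication by it is defined on tempered
distributions. -/
theorem hasTemperateGrowth_dampedSchrodingerSymbol (n : ℕ) (c t : ℝ) :
    (dampedSchrodingerSymbol n c t).HasTemperateGrowth := by
  have h : Function.HasTemperateGrowth (fun ξ : EuclideanSpace ℝ (Fin n) =>
      ((2 * Real.pi) ^ 2 * ‖ξ‖ ^ 2 + c) * t) := by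
    have h0 : Function.HasTemperateGrowth (fun ξ : EuclideanSpace ℝ (Fin n) => ‖ξ‖ ^ 2) :=
      Function.hasTemperateGrowth_norm_sq _
    exact (((Function.HasTemperateGrowth.const _).mul h0).add
      (Function.HasTemperateGrowth.const _)).mul (Function.HasTemperateGrowth.const _)
  have h2 := hasTemperateGrowth_cexp_neg_I_mul.comp h
  have h3 : dampedSchrodingerSymbol n c t = (fun s : ℝ => Complex.exp (-Complex.I * (s : ℂ))) ∘
      (fun ξ : EuclideanSpace ℝ (Fin n) => ((2 * Real.pi) ^ 2 * ‖ξ‖ ^ 2 + c) * t) := by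
    funext ξ
    simp [dampedSchrodingerSymbol, mul_pow]
  rw [h3]
  exact h2

/-- The Fourier side form of the initial value problem, for tempered distributions:
`û_t(λ) = e^{-i(|λ|² + c)t} f̂(λ)` in `𝓢'(ℝⁿ)` for every `t`. -/
def SatisfiesFourierEvolution {n : ℕ} (c : ℝ) (f : 𝓢'(EuclideanSpace ℝ (Fin n), ℂ))
    (u : ℝ → 𝓢'(EuclideanSpace ℝ (Fin n), ℂ)) : Prop :=
  ∀ t : ℝ, 𝓕 (u t) =
    TemperedDistribution.smulLeftCLM ℂ (dampedSchrodingerSymbol n c t) (𝓕 f)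

/-- The tempered distribution `T` is (integration against) the locally integrable function `g`. -/
def IsRepresentedBy {n : ℕ} (T : 𝓢'(EuclideanSpace ℝ (Fin n), ℂ))
    (g : EuclideanSpace ℝ (Fin n) → ℂ) : Prop :=
  LocallyIntegrable g volume ∧
    ∀ φ : 𝓢(EuclideanSpace ℝ (Fin n), ℂ), HasCompactSupport φ → T φ = ∫ x, φ x * g x

/-- The Beurling type condition `∬ |f(x)| |g(y)| e^{|x||y|/(2t₀)} dx dy < ∞`. -/
def BeurlingCondition {n : ℕ} (t₀ : ℝ) (f g : EuclideanSpace ℝ (Fin n) → ℂ) : Prop :=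
  ∫⁻ x : EuclideanSpace ℝ (Fin n), ∫⁻ y : EuclideanSpace ℝ (Fin n),
    ‖f x‖ₑ * ‖g y‖ₑ * ENNReal.ofReal (Real.exp (‖x‖ * ‖y‖ / (2 * t₀))) < ⊤

/-! The Schrödinger propagator at a time `t > 0` is, up to unimodular factors and a nonzero
constant, a rescaled Fourier transform: with `h(x) = f(x) e^{i|x|²/(4t)}` one has `|u(t, y)| = |C|
|𝓕 h (y / (4πt))|` and `|h| = |f|`. Substituting `y = 4πtξ` turns the hypothesis into `∬ |h(x)| |𝓕 h
(ξ)| e^{2π|x||ξ|} dx dξ < ∞`, and Beurling's theorem (`ae_eq_zero_of_beurling`) gives `h = 0`. This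
is part (b), through `ae_eq_kernel_of_isRepresentedBy` and `ae_eq_zero_of_beurlingCondition_kernel`.

Beurling's theorem is reduced to one complex variable. For a unit vector `v`, the inverse transform
of `𝓕 h · e^{-π|ξ|²}` along the line `ℝv` extends to an entire function `G` of order at most two
with `|G(z)| ≤ N(Im z)`, and a completion of the square shows that `|G| N` is integrable on `ℝ`.
Then a primitive of `G(u) G(iu)` is bounded: on the edges of a quadrant one factor has a real
argument and the other an imaginary one, so the integrand is at most `|G(s)| N(s)`;
Phragmén–Lindelöf in slightly smaller sectors fills the quadrant. By Liouville `G(u) G(iu) = 0`,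
hence `G = 0` (`IsBeurlingMajorized.eq_zero`) for every direction `v`, and Fourier inversion gives
`𝓕 h = 0`.

Part (a) is reduced to part (b). A distributional solution, paired with the backward evolution of a
Schwartz function, gives a constant in time, so its Fourier transform evolves by the multiplier
(`IsDampedSchrodingerSolution.satisfiesFourierEvolution`). If `u(t₀) ≠ 0`, the hypothesis itself
forces `f ∈ L¹`; if `u(t₀) = 0`, evolving back gives `f = 0`. -/

/-! ### Primitives along rays and Phragmén–Lindelöf in sectors. -/

/-- The primitive `∫₀ᶻ H` of an entire function, along the segment from `0`. -/
noncomputable def segmentPrimitive (H : ℂ → ℂ) (z : ℂ) : ℂ :=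
  ∫ t in (0 : ℝ)..1, z * H (z * t)

theorem hasDerivAt_segmentPrimitive {H : ℂ → ℂ} (hH : Differentiable ℂ H) (z : ℂ) :
    HasDerivAt (segmentPrimitive H) (H z) z := by
  obtain ⟨P, hP⟩ := hH.isExactOn_univ
  have key : segmentPrimitive H = fun z => P z - P 0 := by
    funext w
    have h1 : ∀ t ∈ Set.uIcc (0 : ℝ) 1,
        HasDerivAt (fun t : ℝ => P (w * t)) (w * H (w * t)) t := by
      intro t _
      have h2 : HasDerivAt (fun t : ℝ => w * (t : ℂ)) w t := by
        simpa using (Complex.ofRealCLM.hasDerivAt (x := t)).const_mul w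
      have h3 := (hP (w * t) (Set.mem_univ _)).comp t h2
      simpa [mul_comm, Function.comp_def] using h3
    have h4 := intervalIntegral.integral_eq_sub_of_hasDerivAt h1
      (Continuous.intervalIntegrable (by have := hH.continuous; fun_prop) _ _)
    simpa [segmentPrimitive] using h4
  rw [key]
  exact (hP z (Set.mem_univ _)).sub_const _

/-- The substitution `s = rt` turns the primitive into an integral of `H` along the ray through `w`,
so an integrable majorant on the ray bounds it uniformly in `r`. -/
theorem norm_segmentPrimitive_ray_le {H : ℂ → ℂ} (hH : Continuous H) {w : ℂ} (hw : ‖w‖ = 1)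
    {a : ℝ → ℝ} (ha : Integrable a) (ha0 : ∀ s, 0 ≤ a s)
    (hb : ∀ s : ℝ, 0 ≤ s → ‖H (w * s)‖ ≤ a s) {r : ℝ} (hr : 0 ≤ r) :
    ‖segmentPrimitive H (w * r)‖ ≤ ∫ s, a s := by
  have h1 : segmentPrimitive H (w * r) = w * ∫ s in (0 : ℝ)..r, H (w * s) := by
    have h2 := intervalIntegral.smul_integral_comp_mul_left (a := 0) (b := 1)
      (fun s : ℝ => w * H (w * s)) r
    simp only [mul_zero, mul_one] at h2
    rw [← intervalIntegral.integral_const_mul, ← h2, segmentPrimitive,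
      ← intervalIntegral.integral_smul]
    congr 1
    funext t
    simp only [Complex.ofReal_mul, Complex.real_smul]
    ring_nf
  rw [h1, norm_mul, hw, one_mul]
  calc ‖∫ s in (0 : ℝ)..r, H (w * s)‖ ≤ ∫ s in (0 : ℝ)..r, ‖H (w * s)‖ :=
        intervalIntegral.norm_integral_le_integral_norm hr
    _ ≤ ∫ s in (0 : ℝ)..r, a s := by
        refine intervalIntegral.integral_mono_on hr ?_ ha.intervalIntegrable
          (fun s hs => hb s hs.1)
        exact Continuous.intervalIntegrable (by fun_prop) _ _
    _ ≤ ∫ s, a s := by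
        rw [intervalIntegral.integral_of_le hr]
        exact setIntegral_le_integral ha (Filter.Eventually.of_forall ha0)

/-- The length `‖z‖` of the segment is absorbed by `e^{‖z‖²}`, whence `B + 1`; only the order two
matters later. -/
theorem norm_segmentPrimitive_le_exp {H : ℂ → ℂ} {A B : ℝ} (hA : 0 ≤ A)
    (hB : 0 ≤ B) (hb : ∀ z, ‖H z‖ ≤ A * Real.exp (B * ‖z‖ ^ 2)) (z : ℂ) :
    ‖segmentPrimitive H z‖ ≤ A * Real.exp ((B + 1) * ‖z‖ ^ 2) := by
  have h1 : ‖segmentPrimitive H z‖ ≤ ‖z‖ * (A * Real.exp (B * ‖z‖ ^ 2)) * |(1 : ℝ) - 0| := by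
    refine intervalIntegral.norm_integral_le_of_norm_le_const (fun t ht => ?_)
    rw [Set.uIoc_of_le zero_le_one] at ht
    rw [norm_mul]
    refine mul_le_mul_of_nonneg_left ((hb _).trans ?_) (norm_nonneg _)
    gcongr
    rw [norm_mul, Complex.norm_real, Real.norm_eq_abs, abs_of_pos ht.1]
    exact mul_le_of_le_one_right (norm_nonneg _) ht.2
  have h2 : ‖z‖ ≤ Real.exp (‖z‖ ^ 2) := by
    have := Real.add_one_le_exp (‖z‖ ^ 2)
    nlinarith [sq_nonneg (‖z‖ - 1 / 2)]
  calc _ ≤ _ := h1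
    _ = ‖z‖ * (A * Real.exp (B * ‖z‖ ^ 2)) := by simp
    _ ≤ Real.exp (‖z‖ ^ 2) * (A * Real.exp (B * ‖z‖ ^ 2)) := by gcongr
    _ = A * Real.exp ((B + 1) * ‖z‖ ^ 2) := by rw [add_mul, Real.exp_add, one_mul]; ring

/-- Phragmén–Lindelöf for functions of order two in a sector of opening less than `π / 2`. -/
theorem norm_le_of_order_two_sector {F : ℂ → ℂ} (hF : Differentiable ℂ F) {A B K α β θ : ℝ}
    (hb : ∀ z, ‖F z‖ ≤ A * Real.exp (B * ‖z‖ ^ 2)) (hαβ : α < β) (hβ : β - α < Real.pi / 2)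
    (h1 : ∀ r : ℝ, 0 ≤ r → ‖F (Complex.exp (α * Complex.I) * r)‖ ≤ K)
    (h2 : ∀ r : ℝ, 0 ≤ r → ‖F (Complex.exp (β * Complex.I) * r)‖ ≤ K)
    (hθ : α ≤ θ) (hθ' : θ ≤ β) {r : ℝ} (hr : 0 < r) :
    ‖F (Complex.exp (θ * Complex.I) * r)‖ ≤ K := by
  have hexp : ∀ ζ : ℂ, Complex.exp ζ
      = Complex.exp (ζ.im * Complex.I) * (Real.exp ζ.re : ℝ) := by
    intro ζ
    conv_lhs => rw [← Complex.re_add_im ζ]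
    rw [Complex.exp_add, Complex.ofReal_exp, mul_comm]
  have hmain := PhragmenLindelof.horizontal_strip (a := α) (b := β) (C := K)
    (f := fun ζ => F (Complex.exp ζ)) (z := (Real.log r : ℂ) + θ * Complex.I)
    (hF.comp Complex.differentiable_exp).diffContOnCl ?_ ?_ ?_ ?_ ?_
  · rw [hexp] at hmain
    have e1 : ((Real.log r : ℂ) + θ * Complex.I).re = Real.log r := by simp
    have e2 : ((Real.log r : ℂ) + θ * Complex.I).im = θ := by simp
    rwa [e1, e2, Real.exp_log hr] at hmain
  -- The exponential map takes the strip `α < Im ζ < β` to the sector, and `|e^ζ|² = e^{2 Re ζ}`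
  -- gives the rate `2`, which is admissible because `2 < π / (β - α)`.
  · refine ⟨2, ?_, |B|, Asymptotics.IsBigO.of_bound |A| (Filter.Eventually.of_forall ?_)⟩
    · rw [lt_div_iff₀ (by linarith)]
      linarith
    · intro ζ
      rw [Real.norm_eq_abs, abs_of_pos (Real.exp_pos _)]
      refine (hb _).trans ?_
      refine mul_le_mul (le_abs_self A) (Real.exp_le_exp.2 ?_) (Real.exp_pos _).le (abs_nonneg _)
      rw [Complex.norm_exp, ← Real.exp_nat_mul]
      refine mul_le_mul (le_abs_self B) (Real.exp_le_exp.2 ?_) (Real.exp_pos _).le (abs_nonneg _)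
      push_cast
      linarith [le_abs_self ζ.re]
  · intro ζ hζ
    rw [hexp, hζ]
    exact h1 _ (Real.exp_pos _).le
  · intro ζ hζ
    rw [hexp, hζ]
    exact h2 _ (Real.exp_pos _).le
  · simpa using hθ
  · simpa using hθ'

/-! ### The one-variable core of Beurling's theorem. -/

/-- An entire function `G` whose size is controlled by a majorant `N` of the imaginary part, of
Gaussian growth, with `G N` integrable on the real line. -/
structure IsBeurlingMajorized (N : ℝ → ℝ) (A B K : ℝ) (G : ℂ → ℂ) : Prop where
  differentiable : Differentiable ℂ G
  norm_le : ∀ z, ‖G z‖ ≤ N z.im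
  mono : ∀ s t, |s| ≤ |t| → N s ≤ N t
  le_exp : ∀ s, N s ≤ A * Real.exp (B * s ^ 2)
  integrable : Integrable (fun r : ℝ => ‖G r‖ * N r)
  integral_le : ∫ r : ℝ, ‖G r‖ * N r ≤ K

namespace IsBeurlingMajorized

variable {N : ℝ → ℝ} {A B K : ℝ} {G G₁ G₂ : ℂ → ℂ}

theorem nonneg (h : IsBeurlingMajorized N A B K G) (s : ℝ) : 0 ≤ N s := by
  simpa using (norm_nonneg _).trans (h.norm_le ((s : ℂ) * Complex.I))

theorem comp_neg (h : IsBeurlingMajorized N A B K G) :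
    IsBeurlingMajorized N A B K (fun z => G (-z)) := by
  have hN : ∀ s, N (-s) = N s := fun s => le_antisymm (h.mono _ _ (by simp)) (h.mono _ _ (by simp))
  have heq : (fun r : ℝ => ‖G (-(r : ℂ))‖ * N r)
      = fun r : ℝ => (fun r : ℝ => ‖G r‖ * N r) (-r) := by
    funext r
    simp [hN]
  refine ⟨h.differentiable.comp differentiable_neg, fun z => ?_, h.mono, h.le_exp, ?_, ?_⟩
  · simpa [hN] using h.norm_le (-z)
  · rw [heq]
    exact h.integrable.comp_neg
  · rw [heq, integral_neg_eq_self (fun r : ℝ => ‖G r‖ * N r)]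
    exact h.integral_le

theorem norm_le_exp (h : IsBeurlingMajorized N A B K G) (hA : 0 ≤ A) (hB : 0 ≤ B) (z : ℂ) :
    ‖G z‖ ≤ A * Real.exp (B * ‖z‖ ^ 2) := by
  refine (h.norm_le z).trans ((h.le_exp _).trans ?_)
  gcongr A * Real.exp (B * ?_)
  rw [← sq_abs]
  gcongr
  exact Complex.abs_im_le_norm z

/-- The full quadrant is the critical opening for order two, so the first factor is rotated by `-α`
and the sector shrinks to `[α, π/2]`. On each edge one factor has the real argument `±s` and the
other an argument of imaginary part `s cos α`, so monotonicity of `N` bounds the integrand by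
`|G(±s)| N(s)`. -/
theorem norm_segmentPrimitive_rotate_le (h₁ : IsBeurlingMajorized N A B K G₁)
    (h₂ : IsBeurlingMajorized N A B K G₂) (hA : 0 ≤ A) (hB : 0 ≤ B) {α θ : ℝ} (hα : 0 < α)
    (hαθ : α ≤ θ) (hθ : θ ≤ Real.pi / 2) (hα' : α < Real.pi / 2) {r : ℝ} (hr : 0 < r) :
    ‖segmentPrimitive (fun u => G₁ (Complex.exp (-(α * Complex.I)) * u) * G₂ (Complex.I * u))
      (Complex.exp (θ * Complex.I) * r)‖ ≤ K := by
  set H : ℂ → ℂ := fun u => G₁ (Complex.exp (-(α * Complex.I)) * u) * G₂ (Complex.I * u) with hH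
  have hHd : Differentiable ℂ H := by
    have := h₁.differentiable
    have := h₂.differentiable
    fun_prop
  have hHb : ∀ z, ‖H z‖ ≤ A ^ 2 * Real.exp (2 * B * ‖z‖ ^ 2) := by
    intro z
    rw [hH, norm_mul]
    have e1 := h₁.norm_le_exp hA hB (Complex.exp (-(α * Complex.I)) * z)
    have e2 := h₂.norm_le_exp hA hB (Complex.I * z)
    have e3 : ‖Complex.exp (-(α * Complex.I))‖ = 1 := by simp [Complex.norm_exp]
    rw [norm_mul, e3, one_mul] at e1
    rw [norm_mul, Complex.norm_I, one_mul] at e2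
    refine (mul_le_mul e1 e2 (norm_nonneg _) (by positivity)).trans (le_of_eq ?_)
    rw [show 2 * B * ‖z‖ ^ 2 = B * ‖z‖ ^ 2 + B * ‖z‖ ^ 2 by ring, Real.exp_add]
    ring
  have hd : Differentiable ℂ (segmentPrimitive H) :=
    fun z => (hasDerivAt_segmentPrimitive hHd z).differentiableAt
  refine norm_le_of_order_two_sector hd
    (norm_segmentPrimitive_le_exp (sq_nonneg A) (by positivity) hHb) hα' (by linarith) ?_ ?_
    hαθ hθ hr
  · intro s hs
    refine (norm_segmentPrimitive_ray_le hHd.continuous (by simp [Complex.norm_exp])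
      h₁.integrable (fun s => mul_nonneg (norm_nonneg _) (h₁.nonneg s)) ?_ hs).trans
      h₁.integral_le
    intro s hs
    rw [hH, norm_mul, ← mul_assoc, ← Complex.exp_add, neg_add_cancel, Complex.exp_zero, one_mul]
    refine mul_le_mul_of_nonneg_left ((h₂.norm_le _).trans (h₁.mono _ _ ?_)) (norm_nonneg _)
    have : (Complex.I * (Complex.exp (α * Complex.I) * s)).im = Real.cos α * s := by
      simp [Complex.exp_ofReal_mul_I_re]
    rw [this, abs_mul]
    exact mul_le_of_le_one_left (abs_nonneg _) (Real.abs_cos_le_one _)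
  · intro s hs
    have h₂' := h₂.comp_neg
    refine (norm_segmentPrimitive_ray_le hHd.continuous (by simp)
      h₂'.integrable (fun s => mul_nonneg (norm_nonneg _) (h₂'.nonneg s)) ?_ hs).trans
      h₂'.integral_le
    intro s hs
    have e : Complex.exp (((Real.pi / 2 : ℝ) : ℂ) * Complex.I) = Complex.I := by
      push_cast
      exact Complex.exp_pi_div_two_mul_I
    rw [hH, norm_mul, e, ← mul_assoc Complex.I, Complex.I_mul_I, neg_one_mul, mul_comm]
    refine mul_le_mul_of_nonneg_left ((h₁.norm_le _).trans (h₁.mono _ _ ?_)) (norm_nonneg _)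
    have : (Complex.exp (-(α * Complex.I)) * (Complex.I * s)).im = Real.cos α * s := by
      rw [show -((α : ℂ) * Complex.I) = ((-α : ℝ) : ℂ) * Complex.I by push_cast; ring,
        ← mul_assoc, mul_comm _ Complex.I, mul_assoc]
      simp only [Complex.I_mul_im, Complex.re_mul_ofReal, Complex.exp_ofReal_mul_I_re, Real.cos_neg]
    rw [this, abs_mul]
    exact mul_le_of_le_one_left (abs_nonneg _) (Real.abs_cos_le_one _)

/-- The bound for the rotated product does not depend on `α`, so `α → 0` gives the open quadrant,
and continuity gives its boundary. -/
theorem norm_segmentPrimitive_le_of_quadrant (h₁ : IsBeurlingMajorized N A B K G₁)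
    (h₂ : IsBeurlingMajorized N A B K G₂) (hA : 0 ≤ A) (hB : 0 ≤ B) {z : ℂ}
    (hre : 0 ≤ z.re) (him : 0 ≤ z.im) :
    ‖segmentPrimitive (fun u => G₁ u * G₂ (Complex.I * u)) z‖ ≤ K := by
  have c₁ := h₁.differentiable.continuous
  have c₂ := h₂.differentiable.continuous
  have hopen : ∀ z : ℂ, 0 < z.re → 0 < z.im →
      ‖segmentPrimitive (fun u => G₁ u * G₂ (Complex.I * u)) z‖ ≤ K := by
    intro z hre him
    have harg0 : 0 < z.arg := by
      refine lt_of_le_of_ne (Complex.arg_nonneg_iff.2 him.le) fun h => ?_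
      exact him.ne' (Complex.arg_eq_zero_iff.1 h.symm).2
    have harg1 : z.arg ≤ Real.pi / 2 := Complex.arg_le_pi_div_two_iff.2 (Or.inl hre.le)
    have hz : z ≠ 0 := by rintro rfl; simp at hre
    have hcont : Continuous fun α : ℝ =>
        segmentPrimitive (fun u => G₁ (Complex.exp (-(α * Complex.I)) * u) * G₂ (Complex.I * u)) z := by
      unfold segmentPrimitive
      exact intervalIntegral.continuous_parametric_intervalIntegral_of_continuous' (by fun_prop) _ _
    have hlim := (hcont.tendsto 0).norm.mono_left
      (nhdsWithin_le_nhds (s := Set.Ioi (0 : ℝ)))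
    simp only [Complex.ofReal_zero, zero_mul, neg_zero, Complex.exp_zero, one_mul] at hlim
    refine le_of_tendsto hlim ?_
    filter_upwards [Ioo_mem_nhdsGT harg0] with α hα
    have := h₁.norm_segmentPrimitive_rotate_le h₂ hA hB hα.1 hα.2.le harg1
      (hα.2.trans_le harg1) (norm_pos_iff.2 hz)
    rwa [mul_comm (Complex.exp _) (‖z‖ : ℂ), Complex.norm_mul_exp_arg_mul_I] at this
  have hcont : Continuous (segmentPrimitive (fun u => G₁ u * G₂ (Complex.I * u))) := by
    unfold segmentPrimitive
    exact intervalIntegral.continuous_parametric_intervalIntegral_of_continuous' (by fun_prop) _ _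
  have hlim : Filter.Tendsto (fun ε : ℝ =>
      ‖segmentPrimitive (fun u => G₁ u * G₂ (Complex.I * u)) (z + ε * (1 + Complex.I))‖)
      (nhdsWithin 0 (Set.Ioi 0))
      (nhds ‖segmentPrimitive (fun u => G₁ u * G₂ (Complex.I * u)) z‖) := by
    have : Continuous fun ε : ℝ =>
      ‖segmentPrimitive (fun u => G₁ u * G₂ (Complex.I * u)) (z + ε * (1 + Complex.I))‖ := by
      fun_prop
    simpa using (this.tendsto 0).mono_left (nhdsWithin_le_nhds (s := Set.Ioi (0 : ℝ)))
  refine le_of_tendsto hlim ?_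
  filter_upwards [self_mem_nhdsWithin] with ε hε
  have hε' : (0 : ℝ) < ε := hε
  exact hopen _ (by simp; linarith) (by simp; linarith)

/-- Multiplication of `z` by `i`, `-i` or `-1` carries the other quadrants to the first one, at the
cost of replacing `G` by `G(-·)` in one or both factors. Liouville makes the primitive constant, and
a product of entire functions vanishes only if a factor does. -/
theorem eq_zero (h : IsBeurlingMajorized N A B K G) (hA : 0 ≤ A) (hB : 0 ≤ B) : G = 0 := by
  have hn := h.comp_neg
  set H : ℂ → ℂ := fun u => G u * G (Complex.I * u) with hH
  have hHd : Differentiable ℂ H := by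
    have := h.differentiable
    fun_prop
  have hbound : ∀ z, ‖segmentPrimitive H z‖ ≤ K := by
    intro z
    rcases le_total 0 z.re with hre | hre <;> rcases le_total 0 z.im with him | him
    · exact h.norm_segmentPrimitive_le_of_quadrant h hA hB hre him
    · have := h.norm_segmentPrimitive_le_of_quadrant hn hA hB (z := Complex.I * z)
        (by simpa using him) (by simpa using hre)
      refine le_of_eq_of_le ?_ this
      rw [segmentPrimitive, segmentPrimitive]
      simp only [mul_assoc, intervalIntegral.integral_const_mul]
      simp only [← mul_assoc Complex.I Complex.I, Complex.I_mul_I, norm_mul, hH, Complex.norm_I,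
        one_mul, neg_mul, neg_neg]
      simp only [mul_comm]
    · have := hn.norm_segmentPrimitive_le_of_quadrant h hA hB (z := -(Complex.I * z))
        (by simpa using him) (by simpa using hre)
      refine le_of_eq_of_le ?_ this
      rw [segmentPrimitive, segmentPrimitive]
      simp only [mul_assoc, intervalIntegral.integral_const_mul, neg_mul, mul_neg, norm_neg,
        intervalIntegral.integral_neg]
      simp only [← mul_assoc Complex.I Complex.I, Complex.I_mul_I, norm_mul, hH, Complex.norm_I,
        one_mul, neg_mul, neg_neg]
      simp only [mul_comm]
    · have := hn.norm_segmentPrimitive_le_of_quadrant hn hA hB (z := -z)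
        (by simpa using hre) (by simpa using him)
      refine le_of_eq_of_le ?_ this
      rw [segmentPrimitive, segmentPrimitive]
      simp only [hH, neg_mul, mul_neg, neg_neg, norm_neg, intervalIntegral.integral_neg]
  have hd : Differentiable ℂ (segmentPrimitive H) :=
    fun z => (hasDerivAt_segmentPrimitive hHd z).differentiableAt
  obtain ⟨k, hk⟩ := hd.exists_eq_const_of_bounded
    (isBounded_iff_forall_norm_le.2 ⟨K, by rintro _ ⟨z, rfl⟩; exact hbound z⟩)
  have hzero : ∀ z, G z * G (Complex.I * z) = 0 := by
    intro z
    have h1 := hasDerivAt_segmentPrimitive hHd z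
    rw [hk] at h1
    exact h1.unique (hasDerivAt_const z k)
  have ha : ∀ g : ℂ → ℂ, Differentiable ℂ g → AnalyticOnNhd ℂ g Set.univ :=
    fun g hg z _ => hg.analyticAt z
  rcases AnalyticOnNhd.eq_zero_or_eq_zero_of_mul_eq_zero (ha _ h.differentiable)
    (ha (fun z => G (Complex.I * z)) (by have := h.differentiable; fun_prop))
    (fun z _ => hzero z) isPreconnected_univ with h0 | h0
  · funext z
    exact h0 z (Set.mem_univ _)
  · funext z
    have := h0 (-(Complex.I * z)) (Set.mem_univ _)
    simpa [← mul_assoc] using this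

end IsBeurlingMajorized

/-! ### Beurling's theorem in several variables. -/

section Beurling

variable {V : Type*} [NormedAddCommGroup V] [InnerProductSpace ℝ V]

theorem norm_cexp_gaussianLine_le {v : V} (hv : ‖v‖ ≤ 1) (z : ℂ) (ξ : V) :
    ‖Complex.exp (-Real.pi * ‖ξ‖ ^ 2 + 2 * Real.pi * Complex.I * z * inner ℝ v ξ)‖
      ≤ Real.exp (-Real.pi * ‖ξ‖ ^ 2 + 2 * Real.pi * |z.im| * ‖ξ‖) := by
  have hin : |inner ℝ v ξ| ≤ ‖ξ‖ :=
    (abs_real_inner_le_norm v ξ).trans (mul_le_of_le_one_left (norm_nonneg _) hv)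
  rw [Complex.norm_exp]
  refine Real.exp_le_exp.2 ?_
  have e : (-(Real.pi : ℂ) * ‖ξ‖ ^ 2 + 2 * Real.pi * Complex.I * z * inner ℝ v ξ).re
      = -Real.pi * ‖ξ‖ ^ 2 + 2 * Real.pi * (-(z.im * inner ℝ v ξ)) := by
    rw [show -(Real.pi : ℂ) * ‖ξ‖ ^ 2 + 2 * Real.pi * Complex.I * z * inner ℝ v ξ
      = ((-Real.pi * ‖ξ‖ ^ 2 : ℝ) : ℂ) + ((2 * Real.pi * inner ℝ v ξ : ℝ) : ℂ) * (Complex.I * z) by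
        push_cast; ring]
    rw [Complex.add_re, Complex.ofReal_re, Complex.re_ofReal_mul, Complex.I_mul_re]
    ring
  rw [e, mul_assoc (2 * Real.pi)]
  gcongr
  calc -(z.im * inner ℝ v ξ) ≤ |z.im * inner ℝ v ξ| := neg_le_abs _
    _ ≤ |z.im| * ‖ξ‖ := by rw [abs_mul]; gcongr

variable [FiniteDimensional ℝ V] [MeasurableSpace V] [BorelSpace V]

theorem integrable_exp_neg_mul_norm_sq {b : ℝ} (hb : 0 < b) :
    Integrable (fun ξ : V => Real.exp (-b * ‖ξ‖ ^ 2)) := by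
  have h := (GaussianFourier.integrable_cexp_neg_mul_sq_norm_add (V := V) (b := b)
    (by simpa using hb) 0 0).norm
  refine h.congr (Filter.Eventually.of_forall fun ξ => ?_)
  simp [Complex.norm_exp, ← Complex.ofReal_pow]

/-- Half of the Gaussian absorbs the linear term by completing the square; the other half is kept
for integrability. -/
theorem exp_neg_mul_sq_add_le {b : ℝ} (hb : 0 < b) (c t : ℝ) :
    Real.exp (-b * t ^ 2 + c * t)
      ≤ Real.exp ((2 * b)⁻¹ * c ^ 2) * Real.exp (-(b / 2) * t ^ 2) := by
  rw [← Real.exp_add]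
  refine Real.exp_le_exp.2 ?_
  have h : 0 ≤ b / 2 * (t - b⁻¹ * c) ^ 2 := by positivity
  have h2 : b / 2 * (t - b⁻¹ * c) ^ 2 = b / 2 * t ^ 2 - c * t + (2 * b)⁻¹ * c ^ 2 := by
    field_simp
    ring
  linarith

theorem integrable_exp_neg_mul_norm_sq_add {b : ℝ} (hb : 0 < b) (c : ℝ) :
    Integrable (fun ξ : V => Real.exp (-b * ‖ξ‖ ^ 2 + c * ‖ξ‖)) := by
  refine ((integrable_exp_neg_mul_norm_sq (V := V) (half_pos hb)).const_mul
    (Real.exp ((2 * b)⁻¹ * c ^ 2))).mono' (by fun_prop) (Filter.Eventually.of_forall fun ξ => ?_)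
  rw [Real.norm_eq_abs, abs_of_pos (Real.exp_pos _)]
  exact exp_neg_mul_sq_add_le hb c ‖ξ‖

/-- The restriction to the line spanned by `v`, continued to complex arguments, of the inverse
Fourier transform of `g` times a Gaussian. -/
noncomputable def gaussianLineIntegral (g : V → ℂ) (v : V) (z : ℂ) : ℂ :=
  ∫ ξ, g ξ * Complex.exp (-Real.pi * ‖ξ‖ ^ 2 + 2 * Real.pi * Complex.I * z * inner ℝ v ξ)

/-- The majorant of `gaussianLineIntegral` as a function of the imaginary part. -/
noncomputable def gaussianLineMajorant (g : V → ℂ) (s : ℝ) : ℝ :=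
  ∫ ξ, ‖g ξ‖ * Real.exp (-Real.pi * ‖ξ‖ ^ 2 + 2 * Real.pi * |s| * ‖ξ‖)

variable {g : V → ℂ} {M : ℝ} {v : V}

theorem integrable_gaussianLineMajorant (hg : Continuous g) (hM : ∀ ξ, ‖g ξ‖ ≤ M) (c : ℝ) :
    Integrable (fun ξ => ‖g ξ‖ * Real.exp (-Real.pi * ‖ξ‖ ^ 2 + c * ‖ξ‖)) := by
  refine ((integrable_exp_neg_mul_norm_sq_add (V := V) Real.pi_pos c).const_mul M).mono'
    (by fun_prop) (Filter.Eventually.of_forall fun ξ => ?_)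
  rw [norm_mul, norm_norm, Real.norm_eq_abs, abs_of_pos (Real.exp_pos _)]
  gcongr
  exact hM ξ

theorem norm_gaussianLineIntegral_le (hg : Continuous g) (hM : ∀ ξ, ‖g ξ‖ ≤ M) (hv : ‖v‖ ≤ 1)
    (z : ℂ) : ‖gaussianLineIntegral g v z‖ ≤ gaussianLineMajorant g z.im := by
  refine norm_integral_le_of_norm_le (integrable_gaussianLineMajorant hg hM _)
    (Filter.Eventually.of_forall fun ξ => ?_)
  rw [norm_mul]
  gcongr
  exact norm_cexp_gaussianLine_le hv z ξ

theorem differentiable_gaussianLineIntegral (hg : Continuous g) (hM : ∀ ξ, ‖g ξ‖ ≤ M)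
    (hv : ‖v‖ ≤ 1) : Differentiable ℂ (gaussianLineIntegral g v) := by
  intro z₀
  -- Differentiation in `z` brings down a factor of size at most `2π‖ξ‖ ≤ e^{2π‖ξ‖}`, the source of
  -- the additional `2π`; the rest of the coefficient comes from `|Im z| ≤ ‖z₀‖ + 1` on the ball.
  have hbd : ∀ ξ : V, ∀ z ∈ Metric.ball z₀ 1,
      ‖g ξ * (Complex.exp (-Real.pi * ‖ξ‖ ^ 2 + 2 * Real.pi * Complex.I * z * inner ℝ v ξ)
        * (2 * Real.pi * Complex.I * inner ℝ v ξ))‖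
      ≤ ‖g ξ‖ * Real.exp (-Real.pi * ‖ξ‖ ^ 2
        + (2 * Real.pi * (‖z₀‖ + 1) + 2 * Real.pi) * ‖ξ‖) := by
    intro ξ z hz
    rw [norm_mul, add_mul, ← add_assoc, Real.exp_add, norm_mul]
    have h1 : |z.im| ≤ ‖z₀‖ + 1 := by
      have : ‖z - z₀‖ < 1 := by simpa [dist_eq_norm] using hz
      have h2 : ‖z‖ ≤ ‖z₀‖ + ‖z - z₀‖ := by
        simpa using norm_add_le z₀ (z - z₀)
      linarith [Complex.abs_im_le_norm z]
    have h3 : ‖(2 * Real.pi * Complex.I * inner ℝ v ξ : ℂ)‖ ≤ Real.exp (2 * Real.pi * ‖ξ‖) := by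
      have hin : |inner ℝ v ξ| ≤ ‖ξ‖ :=
        (abs_real_inner_le_norm v ξ).trans (mul_le_of_le_one_left (norm_nonneg _) hv)
      have h4 : ‖(2 * Real.pi * Complex.I * inner ℝ v ξ : ℂ)‖
          = 2 * Real.pi * |inner ℝ v ξ| := by
        simp [abs_of_pos Real.pi_pos]
      have h5 : 2 * Real.pi * |inner ℝ v ξ| ≤ 2 * Real.pi * ‖ξ‖ := by
        have := Real.pi_pos
        gcongr
      rw [h4]
      linarith [Real.add_one_le_exp (2 * Real.pi * ‖ξ‖)]
    refine mul_le_mul_of_nonneg_left (mul_le_mul ((norm_cexp_gaussianLine_le hv z ξ).trans ?_) h3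
      (norm_nonneg _) (Real.exp_pos _).le) (norm_nonneg _)
    have := Real.pi_pos
    gcongr
  have hint : Integrable (fun ξ => g ξ
      * Complex.exp (-Real.pi * ‖ξ‖ ^ 2 + 2 * Real.pi * Complex.I * z₀ * inner ℝ v ξ)) := by
    refine (integrable_gaussianLineMajorant hg hM (2 * Real.pi * |z₀.im|)).mono'
      (by fun_prop) (Filter.Eventually.of_forall fun ξ => ?_)
    rw [norm_mul]
    gcongr
    exact norm_cexp_gaussianLine_le hv z₀ ξ
  refine (hasDerivAt_integral_of_dominated_loc_of_deriv_le (Metric.ball_mem_nhds z₀ one_pos)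
    (Filter.Eventually.of_forall fun z => by fun_prop) hint
    (F' := fun z ξ => g ξ
      * (Complex.exp (-Real.pi * ‖ξ‖ ^ 2 + 2 * Real.pi * Complex.I * z * inner ℝ v ξ)
        * (2 * Real.pi * Complex.I * inner ℝ v ξ)))
    (by fun_prop)
    (Filter.Eventually.of_forall hbd) (integrable_gaussianLineMajorant hg hM _)
    (Filter.Eventually.of_forall fun ξ z _ => ?_)).2.differentiableAt
  refine HasDerivAt.const_mul _ (HasDerivAt.cexp ?_)
  have := ((hasDerivAt_id z).const_mul (2 * Real.pi * Complex.I * inner ℝ v ξ : ℂ)).const_add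
    (-(Real.pi : ℂ) * ‖ξ‖ ^ 2)
  simp only [mul_one, id] at this
  have hf : (fun w : ℂ => -(Real.pi : ℂ) * ‖ξ‖ ^ 2 + 2 * Real.pi * Complex.I * w * inner ℝ v ξ)
      = fun w => -(Real.pi : ℂ) * ‖ξ‖ ^ 2 + 2 * Real.pi * Complex.I * inner ℝ v ξ * w := by
    funext w
    ring
  rw [hf]
  exact this

theorem gaussianLineMajorant_mono (hg : Continuous g) (hM : ∀ ξ, ‖g ξ‖ ≤ M) {s t : ℝ}
    (h : |s| ≤ |t|) : gaussianLineMajorant g s ≤ gaussianLineMajorant g t := by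
  refine integral_mono (integrable_gaussianLineMajorant hg hM _)
    (integrable_gaussianLineMajorant hg hM _) fun ξ => ?_
  have := Real.pi_pos
  dsimp only
  gcongr

theorem gaussianLineMajorant_le_exp (hg : Continuous g) (hM : ∀ ξ, ‖g ξ‖ ≤ M) (s : ℝ) :
    gaussianLineMajorant g s ≤ (M * ∫ ξ : V, Real.exp (-(Real.pi / 2) * ‖ξ‖ ^ 2))
      * Real.exp (2 * Real.pi * s ^ 2) := by
  have hint : Integrable (fun ξ : V => Real.exp (2 * Real.pi * s ^ 2) *
      (M * Real.exp (-(Real.pi / 2) * ‖ξ‖ ^ 2))) :=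
    ((integrable_exp_neg_mul_norm_sq (V := V) (half_pos Real.pi_pos)).const_mul M).const_mul _
  rw [← integral_const_mul, mul_comm, ← integral_const_mul]
  refine integral_mono (integrable_gaussianLineMajorant hg hM _) hint fun ξ => ?_
  have h := exp_neg_mul_sq_add_le Real.pi_pos (2 * Real.pi * |s|) ‖ξ‖
  have e : (2 * Real.pi)⁻¹ * (2 * Real.pi * |s|) ^ 2 = 2 * Real.pi * s ^ 2 := by
    rw [mul_pow, sq_abs]
    field_simp
  rw [e] at h
  calc ‖g ξ‖ * Real.exp (-Real.pi * ‖ξ‖ ^ 2 + 2 * Real.pi * |s| * ‖ξ‖)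
      ≤ M * (Real.exp (2 * Real.pi * s ^ 2) * Real.exp (-(Real.pi / 2) * ‖ξ‖ ^ 2)) :=
        mul_le_mul (hM ξ) h (Real.exp_pos _).le ((norm_nonneg _).trans (hM ξ))
    _ = _ := by ring

/-- The multiplication formula `∫ 𝓕 h · G = ∫ h · 𝓕 G`, applied to a modulated Gaussian. It serves
twice: with `b = π` for Beurling's theorem, and in the limit of imaginary `b` for the Schrödinger
kernel. -/
theorem integral_fourier_mul_cexp_neg_mul_sq {h : V → ℂ} (hh : Integrable h) {b : ℂ}
    (hb : 0 < b.re) (x : V) :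
    ∫ ξ, 𝓕 h ξ * Complex.exp (-b * ‖ξ‖ ^ 2 + 2 * Real.pi * Complex.I * inner ℝ x ξ)
      = (Real.pi / b) ^ (Module.finrank ℝ V / 2 : ℂ)
        * ∫ y, h y * Complex.exp (-Real.pi ^ 2 * ‖x - y‖ ^ 2 / b) := by
  have hG : Integrable (fun ξ : V => Complex.exp (-b * ‖ξ‖ ^ 2
      + 2 * Real.pi * Complex.I * inner ℝ x ξ)) :=
    GaussianFourier.integrable_cexp_neg_mul_sq_norm_add hb _ _
  have h1 := VectorFourier.integral_fourierIntegral_smul_eq_flip (L := innerₗ V)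
    Real.continuous_fourierChar continuous_inner hh hG
  have h2 : VectorFourier.fourierIntegral Real.fourierChar volume (innerₗ V).flip
      (fun ξ : V => Complex.exp (-b * ‖ξ‖ ^ 2 + 2 * Real.pi * Complex.I * inner ℝ x ξ))
      = fun y => (Real.pi / b) ^ (Module.finrank ℝ V / 2 : ℂ)
        * Complex.exp (-Real.pi ^ 2 * ‖x - y‖ ^ 2 / b) := by
    rw [flip_innerₗ]
    exact funext (fourier_gaussian_innerProductSpace' hb x)
  rw [h2] at h1
  simp only [smul_eq_mul] at h1
  rw [← integral_const_mul]
  refine h1.trans (integral_congr_ae (Filter.Eventually.of_forall fun y => ?_))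
  exact mul_left_comm _ _ _

theorem gaussianLineIntegral_fourier {h : V → ℂ} (hh : Integrable h) (r : ℝ) :
    gaussianLineIntegral (𝓕 h) v r
      = ∫ x, h x * Complex.exp (-Real.pi * ‖r • v - x‖ ^ 2) := by
  have hb : 0 < (Real.pi : ℂ).re := by simpa using Real.pi_pos
  have hpi : (Real.pi : ℂ) ≠ 0 := by exact_mod_cast Real.pi_ne_zero
  have h1 := integral_fourier_mul_cexp_neg_mul_sq hh hb (r • v)
  rw [div_self hpi, Complex.one_cpow, one_mul] at h1
  have e : ∀ x : V, -(Real.pi : ℂ) ^ 2 * ‖r • v - x‖ ^ 2 / Real.pi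
      = -Real.pi * ‖r • v - x‖ ^ 2 := fun x => by field_simp
  simp only [e] at h1
  rw [gaussianLineIntegral, ← h1]
  congr 1
  funext ξ
  congr 2
  rw [real_inner_smul_left]
  push_cast
  ring

/-- On the real line `G` is `h` convolved with a Gaussian, and `‖rv - x‖ ≥ ||r| - ‖x‖|` for a unit
vector `v`. -/
theorem norm_gaussianLineIntegral_fourier_enorm_le {h : V → ℂ} (hh : Integrable h) (hv : ‖v‖ = 1)
    (r : ℝ) : ‖gaussianLineIntegral (𝓕 h) v r‖ₑ
      ≤ ∫⁻ x, ‖h x‖ₑ * ENNReal.ofReal (Real.exp (-Real.pi * (|r| - ‖x‖) ^ 2)) := by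
  rw [gaussianLineIntegral_fourier hh]
  refine (enorm_integral_le_lintegral_enorm _).trans (lintegral_mono fun x => ?_)
  rw [enorm_mul]
  gcongr
  rw [← ofReal_norm, Complex.norm_exp]
  refine ENNReal.ofReal_le_ofReal (Real.exp_le_exp.2 ?_)
  have e : (-(Real.pi : ℂ) * ‖r • v - x‖ ^ 2).re = -Real.pi * ‖r • v - x‖ ^ 2 := by
    rw [← Complex.ofReal_neg, ← Complex.ofReal_pow, ← Complex.ofReal_mul, Complex.ofReal_re]
  rw [e, neg_mul, neg_mul, neg_le_neg_iff]
  refine mul_le_mul_of_nonneg_left ?_ Real.pi_pos.le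
  have h1 := abs_norm_sub_norm_le (r • v) x
  rw [norm_smul, hv, mul_one, Real.norm_eq_abs] at h1
  rw [← sq_abs]
  gcongr

/-- According to the sign of `r`, the integrand is one of two translates of a Gaussian of mass one.
The point is uniformity in `c`. -/
theorem lintegral_exp_neg_abs_sub_sq_le (c : ℝ) :
    ∫⁻ r : ℝ, ENNReal.ofReal (Real.exp (-Real.pi * (|r| - c) ^ 2)) ≤ 2 := by
  have h0 : ∫⁻ r : ℝ, ENNReal.ofReal (Real.exp (-Real.pi * r ^ 2)) = 1 := by
    rw [← ofReal_integral_eq_lintegral_ofReal (integrable_exp_neg_mul_sq Real.pi_pos)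
      (Filter.Eventually.of_forall fun _ => (Real.exp_pos _).le), integral_gaussian,
      div_self Real.pi_ne_zero, Real.sqrt_one, ENNReal.ofReal_one]
  calc ∫⁻ r : ℝ, ENNReal.ofReal (Real.exp (-Real.pi * (|r| - c) ^ 2))
      ≤ ∫⁻ r : ℝ, (ENNReal.ofReal (Real.exp (-Real.pi * (r - c) ^ 2))
        + ENNReal.ofReal (Real.exp (-Real.pi * (r + c) ^ 2))) := by
        refine lintegral_mono fun r => ?_
        rcases abs_cases r with ⟨hr, _⟩ | ⟨hr, _⟩
        · rw [hr]
          exact le_self_add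
        · rw [hr, show (-r - c) ^ 2 = (r + c) ^ 2 by ring]
          exact le_add_self
    _ = 2 := by
        rw [lintegral_add_left (by fun_prop),
          lintegral_sub_right_eq_self (fun r => ENNReal.ofReal (Real.exp (-Real.pi * r ^ 2))) c,
          lintegral_add_right_eq_self (fun r => ENNReal.ofReal (Real.exp (-Real.pi * r ^ 2))) c,
          h0, one_add_one_eq_two]

/-- With `a = ‖x‖`, `b = ‖ξ‖` and `ρ = |r|`, the combined exponent satisfies `-(ρ - a)² - b² + 2ρb =
2ab - (ρ - a - b)²`. After Tonelli the integral over `r` costs at most a factor `2`, leaving exactly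
the Beurling weight. -/
theorem lintegral_gaussianLineIntegral_mul_majorant_lt_top {h : V → ℂ} (hh : Integrable h)
    (hc : Continuous (𝓕 h)) (hM : ∀ ξ, ‖𝓕 h ξ‖ ≤ M) (hv : ‖v‖ = 1)
    (hfin : ∫⁻ x, ∫⁻ ξ, ‖h x‖ₑ * ‖𝓕 h ξ‖ₑ
      * ENNReal.ofReal (Real.exp (2 * Real.pi * ‖x‖ * ‖ξ‖)) < ⊤) :
    ∫⁻ r : ℝ, ‖gaussianLineIntegral (𝓕 h) v r‖ₑ
      * ENNReal.ofReal (gaussianLineMajorant (𝓕 h) r) < ⊤ := by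
  have hhm : AEMeasurable (fun p : V × V => ‖h p.1‖ₑ) (volume.prod volume) :=
    (hh.1.comp_fst (ν := (volume : Measure V))).enorm
  have hhm' : AEMeasurable (fun p : ℝ × (V × V) => ‖h p.2.1‖ₑ)
      ((volume : Measure ℝ).prod (volume.prod volume)) :=
    hhm.comp_quasiMeasurePreserving Measure.quasiMeasurePreserving_snd
  have hpt : ∀ r : ℝ, ‖gaussianLineIntegral (𝓕 h) v r‖ₑ
      * ENNReal.ofReal (gaussianLineMajorant (𝓕 h) r)
      ≤ ∫⁻ p : V × V, (‖h p.1‖ₑ * ENNReal.ofReal (Real.exp (-Real.pi * (|r| - ‖p.1‖) ^ 2)))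
        * (‖𝓕 h p.2‖ₑ * ENNReal.ofReal
          (Real.exp (-Real.pi * ‖p.2‖ ^ 2 + 2 * Real.pi * |r| * ‖p.2‖)))
        ∂(volume.prod volume) := by
    intro r
    have hN : ENNReal.ofReal (gaussianLineMajorant (𝓕 h) r)
        = ∫⁻ ξ, ‖𝓕 h ξ‖ₑ * ENNReal.ofReal
          (Real.exp (-Real.pi * ‖ξ‖ ^ 2 + 2 * Real.pi * |r| * ‖ξ‖)) := by
      rw [gaussianLineMajorant, ofReal_integral_eq_lintegral_ofReal
        (integrable_gaussianLineMajorant hc hM _) (Filter.Eventually.of_forall fun ξ => by positivity)]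
      refine lintegral_congr fun ξ => ?_
      rw [ENNReal.ofReal_mul (norm_nonneg _), ofReal_norm]
    rw [hN, lintegral_prod_mul (μ := (volume : Measure V)) (ν := (volume : Measure V))
      (f := fun x => ‖h x‖ₑ * ENNReal.ofReal (Real.exp (-Real.pi * (|r| - ‖x‖) ^ 2)))
      (g := fun ξ => ‖𝓕 h ξ‖ₑ * ENNReal.ofReal
          (Real.exp (-Real.pi * ‖ξ‖ ^ 2 + 2 * Real.pi * |r| * ‖ξ‖)))
      (hh.1.enorm.mul (by fun_prop)) (hc.enorm.measurable.aemeasurable.mul (by fun_prop))]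
    gcongr
    exact norm_gaussianLineIntegral_fourier_enorm_le hh hv r
  have hmeas : AEMeasurable (Function.uncurry fun (r : ℝ) (p : V × V) =>
      (‖h p.1‖ₑ * ENNReal.ofReal (Real.exp (-Real.pi * (|r| - ‖p.1‖) ^ 2)))
        * (‖𝓕 h p.2‖ₑ * ENNReal.ofReal
          (Real.exp (-Real.pi * ‖p.2‖ ^ 2 + 2 * Real.pi * |r| * ‖p.2‖))))
      ((volume : Measure ℝ).prod (volume.prod volume)) := by
    refine (hhm'.mul (ENNReal.continuous_ofReal.comp (by fun_prop)).aemeasurable).mul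
      (AEMeasurable.mul ?_ (ENNReal.continuous_ofReal.comp (by fun_prop)).aemeasurable)
    exact (hc.comp (continuous_snd.comp continuous_snd)).enorm.aemeasurable
  have hprod : ∫⁻ p : V × V, ‖h p.1‖ₑ * ‖𝓕 h p.2‖ₑ
      * ENNReal.ofReal (Real.exp (2 * Real.pi * ‖p.1‖ * ‖p.2‖)) ∂(volume.prod volume) < ⊤ := by
    rw [lintegral_prod]
    · exact hfin
    · refine (hhm.mul ?_).mul (ENNReal.continuous_ofReal.comp (by fun_prop)).aemeasurable
      exact (hc.comp continuous_snd).enorm.aemeasurable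
  calc ∫⁻ r : ℝ, ‖gaussianLineIntegral (𝓕 h) v r‖ₑ
      * ENNReal.ofReal (gaussianLineMajorant (𝓕 h) r) ≤ _ := lintegral_mono hpt
    _ = _ := lintegral_lintegral_swap hmeas
    _ ≤ ∫⁻ p : V × V, (‖h p.1‖ₑ * ‖𝓕 h p.2‖ₑ
      * ENNReal.ofReal (Real.exp (2 * Real.pi * ‖p.1‖ * ‖p.2‖))) * 2 ∂(volume.prod volume) := by
        refine lintegral_mono fun p => ?_
        have e : ∀ r : ℝ, (‖h p.1‖ₑ * ENNReal.ofReal (Real.exp (-Real.pi * (|r| - ‖p.1‖) ^ 2)))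
            * (‖𝓕 h p.2‖ₑ * ENNReal.ofReal
              (Real.exp (-Real.pi * ‖p.2‖ ^ 2 + 2 * Real.pi * |r| * ‖p.2‖)))
            = (‖h p.1‖ₑ * ‖𝓕 h p.2‖ₑ
              * ENNReal.ofReal (Real.exp (2 * Real.pi * ‖p.1‖ * ‖p.2‖)))
              * ENNReal.ofReal (Real.exp (-Real.pi * (|r| - (‖p.1‖ + ‖p.2‖)) ^ 2)) := by
          intro r
          rw [mul_mul_mul_comm, mul_assoc (‖h p.1‖ₑ * ‖𝓕 h p.2‖ₑ),
            ← ENNReal.ofReal_mul (Real.exp_pos _).le,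
            ← ENNReal.ofReal_mul (Real.exp_pos _).le, ← Real.exp_add, ← Real.exp_add]
          congr 3
          ring
        simp only [e]
        rw [lintegral_const_mul _ (by fun_prop)]
        gcongr
        exact lintegral_exp_neg_abs_sub_sq_le _
    _ < ⊤ := by
        rw [lintegral_mul_const' _ _ (by simp)]
        exact ENNReal.mul_lt_top hprod (by simp)

theorem Real.continuous_fourier_of_integrable {h : V → ℂ} (hh : Integrable h) :
    Continuous (𝓕 h) :=
  VectorFourier.fourierIntegral_continuous Real.continuous_fourierChar continuous_inner hh

theorem Real.norm_fourier_le_integral_norm (h : V → ℂ) (ξ : V) : ‖𝓕 h ξ‖ ≤ ∫ x, ‖h x‖ :=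
  VectorFourier.norm_fourierIntegral_le_integral_norm _ _ _ _ _

/-- A test function is the Fourier transform of a Schwartz function, so its pairing with `h` can be
moved onto `𝓕 h`; no continuity of `h` is required. -/
theorem ae_eq_zero_of_fourier_eq_zero {h : V → ℂ} (hh : Integrable h) (h0 : 𝓕 h = 0) :
    h =ᵐ[volume] 0 := by
  refine ae_eq_zero_of_integral_contDiff_smul_eq_zero hh.locallyIntegrable fun φ hφ hφc => ?_
  have hg₁ : HasCompactSupport (Complex.ofRealCLM ∘ φ) := hφc.comp_left rfl
  have hg₂ : ContDiff ℝ ∞ (Complex.ofRealCLM ∘ φ) := by fun_prop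
  set ψ : 𝓢(V, ℂ) := hg₁.toSchwartzMap hg₂ with hψ
  have h1 := VectorFourier.integral_fourierIntegral_smul_eq_flip (L := innerₗ V)
    Real.continuous_fourierChar continuous_inner hh (𝓕⁻ ψ).integrable (μ := volume) (ν := volume)
  rw [flip_innerₗ] at h1
  have h2 : VectorFourier.fourierIntegral Real.fourierChar volume (innerₗ V) h = 0 := h0
  have h3 : VectorFourier.fourierIntegral Real.fourierChar volume (innerₗ V) (𝓕⁻ ψ : 𝓢(V, ℂ))
      = ψ := by
    have : (𝓕 (𝓕⁻ ψ) : 𝓢(V, ℂ)) = ψ := fourier_fourierInv_eq ψ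
    conv_rhs => rw [← this]
    rfl
  rw [h2, h3] at h1
  simp only [Pi.zero_apply, zero_smul, integral_zero] at h1
  rw [h1]
  congr 1
  funext x
  simp [hψ, mul_comm]

/-- **Beurling's theorem** in several variables, in the form with `‖x‖ ‖ξ‖` in the exponent. -/
theorem ae_eq_zero_of_beurling [Nontrivial V] {h : V → ℂ} (hh : Integrable h)
    (hfin : ∫⁻ x, ∫⁻ ξ, ‖h x‖ₑ * ‖𝓕 h ξ‖ₑ
      * ENNReal.ofReal (Real.exp (2 * Real.pi * ‖x‖ * ‖ξ‖)) < ⊤) :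
    h =ᵐ[volume] 0 := by
  have hc := Real.continuous_fourier_of_integrable hh
  have hM := Real.norm_fourier_le_integral_norm h
  have hM0 : 0 ≤ ∫ x, ‖h x‖ := integral_nonneg fun _ => norm_nonneg _
  have hline : ∀ v : V, ‖v‖ = 1 → gaussianLineIntegral (𝓕 h) v = 0 := by
    intro v hv
    have hmaj : IsBeurlingMajorized (gaussianLineMajorant (𝓕 h))
        ((∫ x, ‖h x‖) * ∫ ξ : V, Real.exp (-(Real.pi / 2) * ‖ξ‖ ^ 2)) (2 * Real.pi)
        (∫ r : ℝ, ‖gaussianLineIntegral (𝓕 h) v r‖ * gaussianLineMajorant (𝓕 h) r)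
        (gaussianLineIntegral (𝓕 h) v) := by
      have hd := differentiable_gaussianLineIntegral hc hM hv.le
      refine ⟨hd, norm_gaussianLineIntegral_le hc hM hv.le,
        fun s t => gaussianLineMajorant_mono hc hM, gaussianLineMajorant_le_exp hc hM, ⟨?_, ?_⟩,
        le_rfl⟩
      · refine AEStronglyMeasurable.mul ?_ ?_
        · exact (hd.continuous.comp Complex.continuous_ofReal).norm.aestronglyMeasurable
        · have hcont : Continuous (fun p : ℝ × V => ‖𝓕 h p.2‖
              * Real.exp (-Real.pi * ‖p.2‖ ^ 2 + 2 * Real.pi * |p.1| * ‖p.2‖)) := by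
            fun_prop
          exact (hcont.stronglyMeasurable.integral_prod_right
            (ν := volume)).aestronglyMeasurable
      · have := lintegral_gaussianLineIntegral_mul_majorant_lt_top hh hc hM hv hfin
        refine lt_of_le_of_lt (lintegral_mono fun r => ?_) this
        rw [enorm_mul, enorm_norm]
        gcongr
        rw [Real.enorm_eq_ofReal]
        exact integral_nonneg fun ξ => by positivity
    refine hmaj.eq_zero ?_ (by positivity)
    exact mul_nonneg hM0 (integral_nonneg fun ξ => (Real.exp_pos _).le)
  -- Every point lies on a line through the origin, so vanishing along all unit directions is
  -- vanishing everywhere. At `x = 0` a unit vector still has to exist, hence `Nontrivial V`.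
  have hpt : ∀ x : V, ∃ v : V, ‖v‖ = 1 ∧ ‖x‖ • v = x := by
    intro x
    rcases eq_or_ne x 0 with rfl | hx
    · obtain ⟨v, hv⟩ := exists_norm_eq V zero_le_one
      exact ⟨v, hv, by simp⟩
    · exact ⟨‖x‖⁻¹ • x, by simp [norm_smul, hx], by simp [smul_smul, hx]⟩
  -- The Gaussian makes `w` integrable, so Fourier inversion applies to `w`, although `𝓕 h` is only
  -- known to be bounded and continuous.
  set w : V → ℂ := fun ξ => 𝓕 h ξ * Complex.exp (-Real.pi * ‖ξ‖ ^ 2) with hw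
  have hwc : Continuous w := by fun_prop
  have hwi : Integrable w := by
    have := integrable_gaussianLineMajorant hc hM 0
    refine this.mono' hwc.aestronglyMeasurable (Filter.Eventually.of_forall fun ξ => ?_)
    rw [hw, norm_mul, Complex.norm_exp]
    simp [← Complex.ofReal_pow]
  have hwF : 𝓕⁻ w = 0 := by
    funext x
    obtain ⟨v, hv, hx⟩ := hpt x
    have h1 := congrFun (hline v hv) (‖x‖ : ℝ)
    rw [Real.fourierInv_eq']
    rw [Pi.zero_apply] at h1
    rw [Pi.zero_apply, ← h1, gaussianLineIntegral]
    congr 1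
    funext ξ
    rw [hw, smul_eq_mul, mul_left_comm, ← Complex.exp_add]
    congr 2
    nth_rewrite 1 [← hx]
    rw [real_inner_smul_right, real_inner_comm]
    push_cast
    ring
  have hwF' : 𝓕 w = 0 := by
    funext x
    have := congrFun hwF (-x)
    rwa [Real.fourierInv_eq_fourier_neg, neg_neg] at this
  have hw0 : w = 0 := by
    have := hwc.fourierInv_fourier_eq hwi (by rw [hwF']; exact integrable_zero _ _ _)
    rw [← this, hwF']
    funext x
    simp [Real.fourierInv_eq']
  refine ae_eq_zero_of_fourier_eq_zero hh ?_
  funext ξ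
  have := congrFun hw0 ξ
  simpa [hw] using this

end Beurling

/-! ### The Gaussian formula on the imaginary axis. -/

section Kernel

variable {V : Type*} [NormedAddCommGroup V] [InnerProductSpace ℝ V] [FiniteDimensional ℝ V]
  [MeasurableSpace V] [BorelSpace V]

/-- The limit case of `integral_fourier_mul_cexp_neg_mul_sq`, which includes imaginary `b`. -/
theorem integral_fourier_mul_cexp_neg_mul_sq_of_re_nonneg {h : V → ℂ} (hh : Integrable h)
    (hF : Integrable (𝓕 h)) {b : ℂ} (hb : 0 ≤ b.re) (hb0 : b ≠ 0) (x : V) :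
    ∫ ξ, 𝓕 h ξ * Complex.exp (-b * ‖ξ‖ ^ 2 + 2 * Real.pi * Complex.I * inner ℝ x ξ)
      = (Real.pi / b) ^ (Module.finrank ℝ V / 2 : ℂ)
        * ∫ y, h y * Complex.exp (-Real.pi ^ 2 * ‖x - y‖ ^ 2 / b) := by
  have hlim : Filter.Tendsto (fun ε : ℝ => b + ε) (nhdsWithin 0 (Set.Ioi 0)) (nhds b) := by
    have : Continuous fun ε : ℝ => b + ε := by fun_prop
    simpa using (this.tendsto 0).mono_left (nhdsWithin_le_nhds (s := Set.Ioi (0 : ℝ)))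
  have hre : ∀ ε : ℝ, ε ∈ Set.Ioi (0 : ℝ) → 0 < (b + ε).re := by
    intro ε hε
    have hε' : (0 : ℝ) < ε := hε
    simp only [Complex.add_re, Complex.ofReal_re]
    linarith
  have hL : Filter.Tendsto (fun ε : ℝ => ∫ ξ, 𝓕 h ξ
        * Complex.exp (-(b + ε) * ‖ξ‖ ^ 2 + 2 * Real.pi * Complex.I * inner ℝ x ξ))
      (nhdsWithin 0 (Set.Ioi 0)) (nhds (∫ ξ, 𝓕 h ξ
        * Complex.exp (-b * ‖ξ‖ ^ 2 + 2 * Real.pi * Complex.I * inner ℝ x ξ))) := by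
    refine tendsto_integral_filter_of_dominated_convergence (fun ξ => ‖𝓕 h ξ‖) ?_ ?_ hF.norm ?_
    · refine Filter.Eventually.of_forall fun ε => hF.1.mul (Continuous.aestronglyMeasurable ?_)
      fun_prop
    · filter_upwards [self_mem_nhdsWithin] with ε hε
      refine Filter.Eventually.of_forall fun ξ => ?_
      rw [norm_mul, Complex.norm_exp]
      refine mul_le_of_le_one_right (norm_nonneg _) (Real.exp_le_one_iff.2 ?_)
      have e : -(b + ε) * (‖ξ‖ : ℂ) ^ 2 + 2 * Real.pi * Complex.I * inner ℝ x ξ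
          = -((‖ξ‖ ^ 2 : ℝ) * (b + ε)) + (2 * Real.pi * inner ℝ x ξ : ℝ) * Complex.I := by
        push_cast
        ring
      rw [e, Complex.add_re, Complex.neg_re, Complex.re_ofReal_mul, Complex.re_ofReal_mul,
        Complex.I_re, mul_zero, add_zero, neg_nonpos]
      exact mul_nonneg (sq_nonneg _) (hre ε hε).le
    · refine Filter.Eventually.of_forall fun ξ => Filter.Tendsto.const_mul _ ?_
      refine (Complex.continuous_exp.tendsto _).comp (Filter.Tendsto.add_const _ ?_)
      exact hlim.neg.mul_const _
  have hR : Filter.Tendsto (fun ε : ℝ => ((Real.pi : ℂ) / (b + ε)) ^ (Module.finrank ℝ V / 2 : ℂ)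
        * ∫ y, h y * Complex.exp (-Real.pi ^ 2 * ‖x - y‖ ^ 2 / (b + ε)))
      (nhdsWithin 0 (Set.Ioi 0)) (nhds ((Real.pi / b) ^ (Module.finrank ℝ V / 2 : ℂ)
        * ∫ y, h y * Complex.exp (-Real.pi ^ 2 * ‖x - y‖ ^ 2 / b))) := by
    refine Filter.Tendsto.mul ?_ ?_
    -- The principal power is continuous at `π / b`: its real part is positive or, when `b` is
    -- imaginary, its imaginary part is nonzero.
    · refine Filter.Tendsto.cpow (tendsto_const_nhds.div hlim hb0) tendsto_const_nhds ?_
      rw [div_eq_mul_inv, Complex.mem_slitPlane_iff, Complex.re_ofReal_mul, Complex.im_ofReal_mul,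
        Complex.inv_re, Complex.inv_im]
      have hn : 0 < Complex.normSq b := Complex.normSq_pos.2 hb0
      rcases hb.lt_or_eq with h | h
      · left
        have := Real.pi_pos
        positivity
      · right
        have him : b.im ≠ 0 := fun him => hb0 (Complex.ext h.symm him)
        exact mul_ne_zero Real.pi_ne_zero (div_ne_zero (neg_ne_zero.2 him) hn.ne')
    · refine tendsto_integral_filter_of_dominated_convergence (fun y => ‖h y‖) ?_ ?_ hh.norm ?_
      · refine Filter.Eventually.of_forall fun ε => hh.1.mul (Continuous.aestronglyMeasurable ?_)
        fun_prop
      · filter_upwards [self_mem_nhdsWithin] with ε hε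
        refine Filter.Eventually.of_forall fun y => ?_
        rw [norm_mul, Complex.norm_exp]
        refine mul_le_of_le_one_right (norm_nonneg _) (Real.exp_le_one_iff.2 ?_)
        have e : -(Real.pi : ℂ) ^ 2 * (‖x - y‖ : ℂ) ^ 2 / (b + ε)
            = -((Real.pi ^ 2 * ‖x - y‖ ^ 2 : ℝ) * (b + ε)⁻¹) := by
          push_cast
          ring
        rw [e, Complex.neg_re, Complex.re_ofReal_mul, Complex.inv_re, neg_nonpos]
        have := (hre ε hε).le
        have := Complex.normSq_nonneg (b + ε)
        positivity
      · refine Filter.Eventually.of_forall fun y => Filter.Tendsto.const_mul _ ?_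
        exact (Complex.continuous_exp.tendsto _).comp (tendsto_const_nhds.div hlim hb0)
  refine tendsto_nhds_unique_of_eventuallyEq hL hR ?_
  filter_upwards [self_mem_nhdsWithin] with ε hε
  exact integral_fourier_mul_cexp_neg_mul_sq hh (hre ε hε) x

end Kernel

/-! ### Weak derivatives in time. -/

section WeakDerivative

/-- A continuous function on the line with vanishing weak derivative is constant. -/
theorem eq_of_forall_integral_deriv_smul_eq_zero {a : ℝ → ℂ} (ha : Continuous a)
    (h : ∀ χ : ℝ → ℝ, ContDiff ℝ ∞ χ → HasCompactSupport χ → ∫ t, deriv χ t • a t = 0)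
    (s t : ℝ) : a s = a t := by
  let φ : ℕ → ContDiffBump (0 : ℝ) := fun k =>
    ⟨(1 / 2) * (1 / ((k : ℝ) + 1)), 1 / ((k : ℝ) + 1), by positivity, by
      have : (0 : ℝ) < 1 / ((k : ℝ) + 1) := by positivity
      linarith⟩
  have hφ : Filter.Tendsto (fun k => (φ k).rOut) Filter.atTop (nhds 0) :=
    tendsto_one_div_add_atTop_nhds_zero_nat
  have hconst : ∀ k, (convolution ((φ k).normed volume) a (ContinuousLinearMap.lsmul ℝ ℝ) volume) s
      = (convolution ((φ k).normed volume) a (ContinuousLinearMap.lsmul ℝ ℝ) volume) t := by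
    intro k
    have hc : HasCompactSupport ((φ k).normed (volume : Measure ℝ)) :=
      (φ k).hasCompactSupport_normed
    have hs : ContDiff ℝ ∞ ((φ k).normed (volume : Measure ℝ)) := (φ k).contDiff_normed
    have hd : ∀ x, HasDerivAt (convolution ((φ k).normed volume) a
        (ContinuousLinearMap.lsmul ℝ ℝ) volume) 0 x := by
      intro x
      have h1 := hc.hasDerivAt_convolution_left (ContinuousLinearMap.lsmul ℝ ℝ)
        (hs.of_le (by exact_mod_cast le_top)) ha.locallyIntegrable x (μ := volume)
      -- The derivative of the mollification at `x` is the weak derivative tested against the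
      -- reflected bump. Each mollification is therefore constant, and so is the limit `a`.
      have h2 := h (fun σ => (φ k).normed volume (x - σ)) (by fun_prop)
        (hc.comp_homeomorph (Homeomorph.subLeft x))
      have h3 : ∀ σ, deriv (fun σ => (φ k).normed volume (x - σ)) σ
          = -deriv ((φ k).normed volume) (x - σ) := fun σ => deriv_comp_const_sub _ _ _
      simp only [h3, neg_smul, integral_neg, neg_eq_zero] at h2
      have h4 : convolution (deriv ((φ k).normed volume)) a
          (ContinuousLinearMap.lsmul ℝ ℝ) volume x = 0 := by
        rw [← h2, convolution_def,
          ← integral_sub_left_eq_self (fun σ => deriv ((φ k).normed volume) (x - σ) • a σ) volume x]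
        simp
      rwa [h4] at h1
    exact is_const_of_deriv_eq_zero (fun x => (hd x).differentiableAt) (fun x => (hd x).deriv) s t
  refine tendsto_nhds_unique
    (ContDiffBump.convolution_tendsto_right_of_continuous (μ := volume) hφ ha s) ?_
  simp only [hconst]
  exact ContDiffBump.convolution_tendsto_right_of_continuous (μ := volume) hφ ha t

/-- A continuous function on the line with continuous weak derivative is its primitive. -/
theorem sub_eq_intervalIntegral_of_weak_deriv {a b : ℝ → ℂ} (ha : Continuous a)
    (hb : Continuous b)
    (h : ∀ χ : ℝ → ℝ, ContDiff ℝ ∞ χ → HasCompactSupport χ →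
      ∫ t, (deriv χ t • a t + χ t • b t) = 0)
    (s t : ℝ) : a t - a s = ∫ τ in s..t, b τ := by
  have hB : ∀ x, HasDerivAt (fun x => ∫ τ in s..x, b τ) (b x) x := fun x =>
    intervalIntegral.integral_hasDerivAt_right (hb.intervalIntegrable _ _)
      hb.stronglyMeasurable.stronglyMeasurableAtFilter hb.continuousAt
  have hBc : Continuous fun x => ∫ τ in s..x, b τ :=
    continuous_iff_continuousAt.2 fun x => (hB x).continuousAt
  have key := eq_of_forall_integral_deriv_smul_eq_zero
    (a := fun x => a x - ∫ τ in s..x, b τ) (ha.sub hBc) (fun χ hχ hχc => ?_) t s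
  · simp only [intervalIntegral.integral_same, sub_zero] at key
    rw [← key]
    ring
  · have hd : Continuous (deriv χ) := hχ.continuous_deriv (by exact_mod_cast le_top)
    have i1 : Integrable fun t => χ t • b t :=
      (hχ.continuous.smul hb).integrable_of_hasCompactSupport hχc.smul_right
    have i2 : Integrable fun t => deriv χ t • a t :=
      (hd.smul ha).integrable_of_hasCompactSupport hχc.deriv.smul_right
    have i3 : Integrable fun t => deriv χ t • ∫ τ in s..t, b τ :=
      (hd.smul hBc).integrable_of_hasCompactSupport hχc.deriv.smul_right
    have i4 : Integrable fun t => χ t • ∫ τ in s..t, b τ :=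
      (hχ.continuous.smul hBc).integrable_of_hasCompactSupport hχc.smul_right
    have hibp := integral_bilinear_hasDerivAt_right_eq_neg_left_of_integrable
      (L := ContinuousLinearMap.lsmul ℝ ℝ) (u := χ) (u' := deriv χ)
      (v := fun x => ∫ τ in s..x, b τ) (v' := b)
      (fun x _ => (hχ.differentiable (by simp)).differentiableAt.hasDerivAt)
      (fun x _ => hB x) i1 i3 i4
    simp only [ContinuousLinearMap.lsmul_apply] at hibp
    have h1 := h χ hχ hχc
    rw [integral_add i2 i1, hibp] at h1
    simp only [smul_sub]
    rw [integral_sub i2 i3, sub_eq_add_neg, h1]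

end WeakDerivative

/-! ### From compactly supported to Schwartz test functions. -/

section Cutoff

variable {V : Type*} [NormedAddCommGroup V] [InnerProductSpace ℝ V] [FiniteDimensional ℝ V]

theorem norm_laplacian_le (f : V → ℂ) (x : V) :
    ‖Δ f x‖ ≤ Module.finrank ℝ V * ‖iteratedFDeriv ℝ 2 f x‖ := by
  rw [InnerProductSpace.laplacian_eq_iteratedFDeriv_stdOrthonormalBasis]
  refine (norm_sum_le_of_le _ fun i _ => ((iteratedFDeriv ℝ 2 f x).le_opNorm _)).trans ?_
  simp

/-- The smooth cutoff to balls of radius about `k + 1`. -/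
noncomputable def smoothCutoff (V : Type*) [NormedAddCommGroup V] [InnerProductSpace ℝ V]
    [FiniteDimensional ℝ V] (k : ℕ) (x : V) : ℝ :=
  (⟨1, 2, one_pos, one_lt_two⟩ : ContDiffBump (0 : V)) (((k : ℝ) + 1)⁻¹ • x)

theorem contDiff_smoothCutoff (k : ℕ) : ContDiff ℝ ∞ (smoothCutoff V k) :=
  (ContDiffBump.contDiff _).comp (contDiff_const_smul _)

theorem hasCompactSupport_smoothCutoff (k : ℕ) : HasCompactSupport (smoothCutoff V k) :=
  (ContDiffBump.hasCompactSupport _).comp_smul (by positivity)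

theorem smoothCutoff_eventually_eq_one (x : V) :
    ∀ᶠ k in Filter.atTop, smoothCutoff V k =ᶠ[nhds x] 1 := by
  have hlim : Filter.Tendsto (fun k : ℕ => ((k : ℝ) + 1)⁻¹ • x) Filter.atTop (nhds 0) := by
    have := (tendsto_one_div_add_atTop_nhds_zero_nat (𝕜 := ℝ)).smul_const x
    simpa using this
  filter_upwards [hlim.eventually (Metric.ball_mem_nhds (0 : V) one_pos)] with k hk
  have hcont : Continuous fun y : V => ((k : ℝ) + 1)⁻¹ • y := continuous_const_smul _
  have hnear := hcont.continuousAt.eventually (Metric.isOpen_ball.mem_nhds hk)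
  filter_upwards [hnear] with y hy
  exact ContDiffBump.one_of_mem_closedBall _ (Metric.ball_subset_closedBall hy)

/-- Each cutoff is a fixed bump composed with a dilation of factor at most one, which can only
shrink derivatives; hence uniformity in `k`. -/
theorem exists_norm_iteratedFDeriv_smoothCutoff_le (i : ℕ) :
    ∃ C : ℝ, 0 ≤ C ∧ ∀ (k : ℕ) (x : V), ‖iteratedFDeriv ℝ i (smoothCutoff V k) x‖ ≤ C := by
  set η : ContDiffBump (0 : V) := ⟨1, 2, one_pos, one_lt_two⟩ with hη
  obtain ⟨C, hC0, hC⟩ := (η.hasCompactSupport.toSchwartzMap η.contDiff).decay 0 i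
  refine ⟨C, hC0.le, fun k x => ?_⟩
  have hr : |((k : ℝ) + 1)⁻¹| ≤ 1 := by
    rw [abs_of_pos (by positivity)]
    exact inv_le_one_of_one_le₀ (by linarith [Nat.cast_nonneg (α := ℝ) k])
  set L : V →L[ℝ] V := ((k : ℝ) + 1)⁻¹ • ContinuousLinearMap.id ℝ V with hL
  have hLn : ‖L‖ ≤ 1 := by
    rw [hL, norm_smul, Real.norm_eq_abs]
    exact mul_le_one₀ hr (norm_nonneg _) ContinuousLinearMap.norm_id_le
  have e : smoothCutoff V k = η ∘ L := rfl
  rw [e, L.iteratedFDeriv_comp_right (η.contDiff (n := ⊤)) x (by exact_mod_cast le_top)]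
  refine (ContinuousMultilinearMap.norm_compContinuousLinearMap_le _ _).trans ?_
  have h1 : ‖iteratedFDeriv ℝ i η (L x)‖ ≤ C := by
    have := hC (L x)
    rwa [pow_zero, one_mul] at this
  refine (mul_le_of_le_one_right (norm_nonneg _) ?_).trans h1
  exact Finset.prod_le_one (fun _ _ => norm_nonneg _) (fun _ _ => hLn)

/-- The truncation of a Schwartz function by `smoothCutoff`. -/
noncomputable def truncate (k : ℕ) (ψ : 𝓢(V, ℂ)) : 𝓢(V, ℂ) :=
  HasCompactSupport.toSchwartzMap (f := fun x => smoothCutoff V k x • ψ x)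
    ((hasCompactSupport_smoothCutoff k).smul_right)
    ((contDiff_smoothCutoff k).smul (ψ.smooth ⊤))

theorem hasCompactSupport_truncate (k : ℕ) (ψ : 𝓢(V, ℂ)) : HasCompactSupport (truncate k ψ) :=
  (hasCompactSupport_smoothCutoff k).smul_right

theorem truncate_apply (k : ℕ) (ψ : 𝓢(V, ℂ)) (x : V) :
    truncate k ψ x = smoothCutoff V k x • ψ x := rfl

theorem truncate_eventuallyEq (ψ : 𝓢(V, ℂ)) (x : V) :
    ∀ᶠ k in Filter.atTop, (truncate k ψ : V → ℂ) =ᶠ[nhds x] ψ := by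
  filter_upwards [smoothCutoff_eventually_eq_one x] with k hk
  filter_upwards [hk] with y hy
  rw [truncate_apply, hy, Pi.one_apply, one_smul]

variable [MeasurableSpace V] [BorelSpace V]

/-- By the Leibniz rule the derivatives of `ψ` up to order two give one `L²` majorant for all `k`,
as dominated convergence against an `L²` function demands. -/
theorem exists_memLp_bound_truncate (ψ : 𝓢(V, ℂ)) :
    ∃ B : V → ℝ, MemLp B 2 volume ∧ ∀ (k : ℕ) (x : V),
      ‖truncate k ψ x‖ ≤ B x ∧ ‖Δ (truncate k ψ) x‖ ≤ B x := by
  obtain ⟨C₀, hC₀, h₀⟩ := exists_norm_iteratedFDeriv_smoothCutoff_le (V := V) 0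
  obtain ⟨C₁, hC₁, h₁⟩ := exists_norm_iteratedFDeriv_smoothCutoff_le (V := V) 1
  obtain ⟨C₂, hC₂, h₂⟩ := exists_norm_iteratedFDeriv_smoothCutoff_le (V := V) 2
  set d : ℝ := (Module.finrank ℝ V : ℝ) with hd
  have hd0 : 0 ≤ d := Nat.cast_nonneg _
  set A₀ : V → ℝ := fun x => ‖ψ x‖ with hA₀
  set A₁ : V → ℝ := fun x => ‖fderivCLM ℝ V ℂ ψ x‖ with hA₁
  set A₂ : V → ℝ := fun x => ‖fderivCLM ℝ V _ (fderivCLM ℝ V ℂ ψ) x‖ with hA₂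
  have m₀ : MemLp A₀ 2 volume := (ψ.memLp 2).norm
  have m₁ : MemLp A₁ 2 volume := ((fderivCLM ℝ V ℂ ψ).memLp 2).norm
  have m₂ : MemLp A₂ 2 volume := ((fderivCLM ℝ V _ (fderivCLM ℝ V ℂ ψ)).memLp 2).norm
  have e₀ : ∀ x, ‖iteratedFDeriv ℝ 0 ψ x‖ = A₀ x := fun x => norm_iteratedFDeriv_zero
  have e₁ : ∀ x, ‖iteratedFDeriv ℝ 1 ψ x‖ = A₁ x := fun x => norm_iteratedFDeriv_one _
  have e₂ : ∀ x, ‖iteratedFDeriv ℝ 2 ψ x‖ = A₂ x := by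
    intro x
    rw [← norm_iteratedFDeriv_fderiv, norm_iteratedFDeriv_one]
    rfl
  have b₀ : ∀ x, 0 ≤ A₀ x := fun x => norm_nonneg _
  have b₁ : ∀ x, 0 ≤ A₁ x := fun x => norm_nonneg _
  have b₂ : ∀ x, 0 ≤ A₂ x := fun x => norm_nonneg _
  refine ⟨fun x => C₀ * A₀ x + d * (C₀ * A₂ x + 2 * C₁ * A₁ x + C₂ * A₀ x), ?_, fun k x => ⟨?_, ?_⟩⟩
  · exact (m₀.const_mul C₀).add ((((m₂.const_mul C₀).add (m₁.const_mul (2 * C₁))).add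
      (m₀.const_mul C₂)).const_mul d)
  · have := h₀ k x
    rw [norm_iteratedFDeriv_zero] at this
    rw [truncate_apply, norm_smul]
    have h3 : ‖smoothCutoff V k x‖ * ‖ψ x‖ ≤ C₀ * A₀ x := by
      gcongr
    have h4 : 0 ≤ d * (C₀ * A₂ x + 2 * C₁ * A₁ x + C₂ * A₀ x) := by
      have := b₀ x
      have := b₁ x
      have := b₂ x
      positivity
    linarith
  · have h3 := norm_iteratedFDeriv_smul_le (contDiff_smoothCutoff (V := V) k) (ψ.smooth ⊤) x
      (n := 2) (WithTop.coe_le_coe.2 (le_top : (2 : ℕ∞) ≤ ⊤))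
    simp only [Finset.sum_range_succ, Finset.range_zero, Finset.sum_empty, zero_add,
      Nat.choose_zero_right, Nat.choose_self, Nat.cast_one, one_mul, Nat.sub_zero,
      Nat.choose_one_right, Nat.cast_ofNat, e₀, e₂, Nat.add_one_sub_one, e₁] at h3
    have h4 : ‖iteratedFDeriv ℝ 2 (truncate k ψ) x‖ ≤ C₀ * A₂ x + 2 * C₁ * A₁ x + C₂ * A₀ x := by
      refine h3.trans ?_
      gcongr
      · exact h₀ k x
      · exact h₁ k x
      · exact h₂ k x
    have h5 : 0 ≤ C₀ * A₀ x := mul_nonneg hC₀ (b₀ x)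
    rw [SchwartzMap.laplacian_apply]
    refine (norm_laplacian_le _ x).trans ?_
    have h6 := mul_le_mul_of_nonneg_left h4 hd0
    linarith

theorem tendsto_integral_mul_of_eventually_eq {F : V → ℂ} (hF : MemLp F 2 volume) {B : V → ℝ}
    (hB : MemLp B 2 volume) {w : ℕ → V → ℂ} {w' : V → ℂ} (hw : ∀ k, Continuous (w k))
    (hwB : ∀ k x, ‖w k x‖ ≤ B x) (hlim : ∀ x, ∀ᶠ k in Filter.atTop, w k x = w' x) :
    Filter.Tendsto (fun k => ∫ x, F x * w k x) Filter.atTop (nhds (∫ x, F x * w' x)) := by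
  refine tendsto_integral_of_dominated_convergence (fun x => ‖F x‖ * B x)
    (fun k => hF.1.mul (hw k).aestronglyMeasurable) (hF.norm.integrable_mul hB)
    (fun k => Filter.Eventually.of_forall fun x => ?_) (Filter.Eventually.of_forall fun x => ?_)
  · rw [norm_mul]
    exact mul_le_mul_of_nonneg_left (hwB k x) (norm_nonneg _)
  · refine tendsto_const_nhds.congr' ?_
    filter_upwards [hlim x] with k hk
    rw [hk]

end Cutoff

/-! ### The duality argument for weak evolutions. -/

/-- If `⟨u t - u s, v r⟩ = ⟨∫ u, v' r⟩`, then `⟨u τ, v (t - τ)⟩` does not depend on `τ`. -/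
theorem pairing_eq_of_weak_evolution {X Y Z : Type*} [NormedAddCommGroup X] [NormedSpace ℝ X]
    [CompleteSpace X] [NormedAddCommGroup Y] [NormedSpace ℝ Y] [NormedAddCommGroup Z]
    [NormedSpace ℝ Z] (L : X →L[ℝ] Y →L[ℝ] Z) {u : ℝ → X} (hu : Continuous u)
    {v v₁ v₂ : ℝ → Y} (hv : ∀ s, HasDerivAt v (v₁ s) s) (hv₁ : ∀ s, HasDerivAt v₁ (v₂ s) s)
    (h : ∀ r s t, L (u t - u s) (v r) = L (∫ τ in s..t, u τ) (v₁ r)) (t : ℝ) :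
    L (u t) (v 0) = L (u 0) (v t) := by
  have hder : ∀ τ₀ : ℝ, HasDerivAt (fun τ => L (u τ) (v (t - τ))) 0 τ₀ := by
    intro τ₀
    have hsub : HasDerivAt (fun τ : ℝ => t - τ) (-1) τ₀ := by
      simpa using (hasDerivAt_id τ₀).const_sub t
    have h1 : HasDerivAt (fun τ => v (t - τ)) (-v₁ (t - τ₀)) τ₀ := by
      simpa [Function.comp_def] using (hv (t - τ₀)).scomp τ₀ hsub
    have h2 : HasDerivAt (fun τ => v₁ (t - τ)) (-v₂ (t - τ₀)) τ₀ := by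
      simpa [Function.comp_def] using (hv₁ (t - τ₀)).scomp τ₀ hsub
    have h3 : HasDerivAt (fun τ => ∫ σ in τ₀..τ, u σ) (u τ₀) τ₀ :=
      intervalIntegral.integral_hasDerivAt_right (hu.intervalIntegrable _ _)
        (hu.stronglyMeasurableAtFilter _ _) hu.continuousAt
    have h4 : HasDerivAt (fun τ => L (∫ σ in τ₀..τ, u σ)) (L (u τ₀)) τ₀ :=
      L.hasFDerivAt.comp_hasDerivAt τ₀ h3
    have h5 := h4.clm_apply h2
    have h6 : HasDerivAt (fun τ => L (u τ₀) (v (t - τ))) (L (u τ₀) (-v₁ (t - τ₀))) τ₀ :=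
      (L (u τ₀)).hasFDerivAt.comp_hasDerivAt τ₀ h1
    have h7 := h6.add h5
    -- Since `u` need not be differentiable, `L (u τ)` is split as `L (u τ₀)` plus the increment,
    -- which `h` rewrites as an integral differentiable in `τ`. At `τ = τ₀` the two `v₁` terms
    -- cancel, and `v₂` meets an integral over an empty interval.
    have hz : L (u τ₀) (-v₁ (t - τ₀)) + (L (u τ₀) (v₁ (t - τ₀))
        + L (∫ σ in τ₀..τ₀, u σ) (-v₂ (t - τ₀))) = 0 := by
      simp
    rw [hz] at h7
    refine h7.congr_of_eventuallyEq (Filter.Eventually.of_forall fun τ => ?_)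
    have := h (t - τ) τ₀ τ
    rw [map_sub, sub_apply] at this
    simp only [Pi.add_apply]
    rw [← this, add_sub_cancel]
  have := is_const_of_deriv_eq_zero (fun τ => (hder τ).differentiableAt)
    (fun τ => (hder τ).deriv) t 0
  simpa using this

/-- Taylor's bound serves for `|x| ≤ 1`; for `|x| > 1` the crude bound `2 + |x| ≤ 3x²` explains the
constant. -/
theorem Complex.norm_exp_mul_I_sub_one_sub_le (x : ℝ) :
    ‖Complex.exp (x * Complex.I) - 1 - x * Complex.I‖ ≤ 3 * x ^ 2 := by
  have hn : ‖(x * Complex.I : ℂ)‖ = |x| := by simp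
  rcases le_or_gt |x| 1 with h | h
  · refine (Complex.norm_exp_sub_one_sub_id_le (by rwa [hn])).trans ?_
    rw [hn, sq_abs]
    nlinarith [sq_nonneg x]
  · refine (norm_sub_le _ _).trans ?_
    rw [hn]
    have h1 : ‖Complex.exp (x * Complex.I) - 1‖ ≤ 2 := by
      refine (norm_sub_le _ _).trans ?_
      rw [Complex.norm_exp_ofReal_mul_I, norm_one]
      norm_num
    nlinarith [sq_abs x]

/-! ### The Schrödinger kernel and part (b). -/

section Schrodinger

variable {n : ℕ}

local notation "E" => EuclideanSpace ℝ (Fin n)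

/-- The constant in front of the Schrödinger kernel at time `t`. -/
noncomputable def schrodingerKernelConst (n : ℕ) (c t : ℝ) : ℂ :=
  Complex.exp (-Complex.I * (c * t))
    * (Real.pi / (4 * Real.pi ^ 2 * t * Complex.I)) ^ (n / 2 : ℂ)

theorem schrodingerKernelConst_ne_zero (c : ℝ) {t : ℝ} (ht : 0 < t) :
    schrodingerKernelConst n c t ≠ 0 := by
  have hpi : (Real.pi : ℂ) ≠ 0 := by exact_mod_cast Real.pi_ne_zero
  have ht' : (t : ℂ) ≠ 0 := by exact_mod_cast ht.ne'
  refine mul_ne_zero (Complex.exp_ne_zero _) ?_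
  rw [Complex.cpow_def_of_ne_zero
    (div_ne_zero hpi (by simp [hpi, ht'])) ]
  exact Complex.exp_ne_zero _

theorem norm_dampedSchrodingerSymbol (c t : ℝ) (ξ : E) : ‖dampedSchrodingerSymbol n c t ξ‖ = 1 := by
  rw [dampedSchrodingerSymbol, neg_mul, mul_comm, ← neg_mul, ← Complex.ofReal_neg,
    Complex.norm_exp_ofReal_mul_I]

/-- The kernel representation of the damped Schrödinger group on Schwartz functions. -/
theorem fourier_symbol_fourierInv_apply (c : ℝ) {t : ℝ} (ht : 0 < t) (φ : 𝓢(E, ℂ)) (x : E) :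
    𝓕 (SchwartzMap.smulLeftCLM ℂ (dampedSchrodingerSymbol n c t) (𝓕⁻ φ)) x
      = schrodingerKernelConst n c t
        * ∫ y, φ y * Complex.exp (‖x - y‖ ^ 2 / (4 * t) * Complex.I) := by
  have hpi : (Real.pi : ℂ) ≠ 0 := by exact_mod_cast Real.pi_ne_zero
  have ht' : (t : ℂ) ≠ 0 := by exact_mod_cast ht.ne'
  have hb0 : (4 * Real.pi ^ 2 * t * Complex.I : ℂ) ≠ 0 := by simp [hpi, ht']
  have hbre : 0 ≤ (4 * Real.pi ^ 2 * t * Complex.I : ℂ).re := by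
    have : (4 * Real.pi ^ 2 * t * Complex.I : ℂ) = (4 * Real.pi ^ 2 * t : ℝ) * Complex.I := by
      push_cast
      ring
    rw [this, Complex.re_ofReal_mul, Complex.I_re, mul_zero]
  -- Apart from the factor `e^{-ict}`, the symbol is `e^{-b|ξ|²}` with `b = 4π²it`, which is why the
  -- formula on the imaginary axis is needed.
  have h1 := integral_fourier_mul_cexp_neg_mul_sq_of_re_nonneg φ.integrable (𝓕 φ).integrable
    hbre hb0 x
  rw [finrank_euclideanSpace_fin] at h1
  have e : ∀ y : E, -(Real.pi : ℂ) ^ 2 * ‖x - y‖ ^ 2 / (4 * Real.pi ^ 2 * t * Complex.I)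
      = ‖x - y‖ ^ 2 / (4 * t) * Complex.I := by
    intro y
    have hI := Complex.I_ne_zero
    have hI2 := Complex.I_sq
    field_simp
    rw [hI2, mul_neg_one]
  simp only [e] at h1
  rw [schrodingerKernelConst, mul_assoc, ← h1, ← integral_const_mul, fourier_coe, Real.fourier_eq',
    ← integral_neg_eq_self]
  congr 1
  funext ξ
  have hm : dampedSchrodingerSymbol n c t (-ξ) = Complex.exp (-Complex.I * (c * t))
      * Complex.exp (-(4 * Real.pi ^ 2 * t * Complex.I) * ‖ξ‖ ^ 2) := by
    rw [dampedSchrodingerSymbol, ← Complex.exp_add, norm_neg]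
    congr 1
    push_cast
    ring
  have hinv : (𝓕⁻ φ : 𝓢(E, ℂ)) (-ξ) = 𝓕 (φ : E → ℂ) ξ := by
    rw [fourierInv_coe, Real.fourierInv_eq_fourier_neg, neg_neg]
  rw [SchwartzMap.smulLeftCLM_apply_apply (hasTemperateGrowth_dampedSchrodingerSymbol n c t),
    hm, hinv, inner_neg_left, Complex.exp_add, real_inner_comm]
  simp only [smul_eq_mul]
  rw [show (((-2 * Real.pi * -inner ℝ x ξ : ℝ) : ℂ) * Complex.I)
    = 2 * Real.pi * Complex.I * inner ℝ x ξ by push_cast; ring]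
  ring

/-- The modulation of `f` by the Gaussian phase of the Schrödinger kernel at time `t`. -/
noncomputable def gaussianModulation (t : ℝ) (f : E → ℂ) (x : E) : ℂ :=
  f x * Complex.exp (‖x‖ ^ 2 / (4 * t) * Complex.I)

theorem norm_gaussianModulation (t : ℝ) (f : E → ℂ) (x : E) :
    ‖gaussianModulation t f x‖ = ‖f x‖ := by
  rw [gaussianModulation, norm_mul,
    show (‖x‖ ^ 2 / (4 * t) * Complex.I : ℂ) = ((‖x‖ ^ 2 / (4 * t) : ℝ) : ℂ) * Complex.I by
      push_cast; ring, Complex.norm_exp_ofReal_mul_I, mul_one]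

theorem integrable_gaussianModulation (t : ℝ) {f : E → ℂ} (hf : Integrable f) :
    Integrable (gaussianModulation t f) := by
  refine hf.mono (hf.1.mul (Continuous.aestronglyMeasurable (by fun_prop)))
    (Filter.Eventually.of_forall fun x => ?_)
  rw [norm_gaussianModulation]

/-- In the expansion of `|x - y|²` the cross term becomes `-2⟨x, y⟩ / (4t) = -2π⟨x, y / (4πt)⟩`, a
Fourier phase at frequency `y / (4πt)`. -/
theorem integral_mul_cexp_norm_sub_sq {t : ℝ} (ht : 0 < t) (f : E → ℂ) (y : E) :
    ∫ x, f x * Complex.exp (‖x - y‖ ^ 2 / (4 * t) * Complex.I)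
      = Complex.exp (‖y‖ ^ 2 / (4 * t) * Complex.I)
        * 𝓕 (gaussianModulation t f) ((4 * Real.pi * t)⁻¹ • y) := by
  have hpi : (Real.pi : ℂ) ≠ 0 := by exact_mod_cast Real.pi_ne_zero
  have ht' : (t : ℂ) ≠ 0 := by exact_mod_cast ht.ne'
  rw [Real.fourier_eq', ← integral_const_mul]
  congr 1
  funext x
  rw [gaussianModulation, smul_eq_mul, mul_comm (Complex.exp (((-2 * _ * _ : ℝ) : ℂ) * _)),
    mul_assoc, mul_left_comm (Complex.exp _) (f x), ← Complex.exp_add, ← Complex.exp_add]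
  congr 2
  rw [real_inner_smul_right, ← Complex.ofReal_pow ‖x - y‖, norm_sub_sq_real]
  push_cast
  field_simp
  ring

/-- The solution at a positive time is given by the Schrödinger kernel. -/
theorem ae_eq_kernel_of_isRepresentedBy {c t : ℝ} (ht : 0 < t)
    (f : Lp ℂ 1 (volume : Measure E)) {T : 𝓢'(E, ℂ)} {g : E → ℂ}
    (hT : 𝓕 T = TemperedDistribution.smulLeftCLM ℂ (dampedSchrodingerSymbol n c t)
      (𝓕 (Lp.toTemperedDistribution f))) (hg : IsRepresentedBy T g) :
    g =ᵐ[volume] fun y => schrodingerKernelConst n c t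
      * (Complex.exp (‖y‖ ^ 2 / (4 * t) * Complex.I)
        * 𝓕 (gaussianModulation t f) ((4 * Real.pi * t)⁻¹ • y)) := by
  have hf : Integrable f := L1.integrable_coeFn f
  have hcont := Real.continuous_fourier_of_integrable (integrable_gaussianModulation t hf)
  refine ae_eq_of_integral_contDiff_smul_eq hg.1
    (Continuous.locallyIntegrable (by fun_prop)) fun φ hφ hφc => ?_
  have hg₁ : HasCompactSupport (Complex.ofRealCLM ∘ φ) := hφc.comp_left rfl
  have hg₂ : ContDiff ℝ ∞ (Complex.ofRealCLM ∘ φ) := by fun_prop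
  set ψ : 𝓢(E, ℂ) := hg₁.toSchwartzMap hg₂ with hψ
  have hψφ : ∀ x, ψ x = φ x := fun x => rfl
  have h1 : T ψ = ∫ x, φ x • g x := by
    rw [hg.2 ψ hg₁]
    simp [hψφ]
  have h2 : T ψ = ∫ x, f x * (schrodingerKernelConst n c t
        * ∫ y, ψ y * Complex.exp (‖x - y‖ ^ 2 / (4 * t) * Complex.I)) := by
    -- The evolution is transposed onto the test function, where the kernel is an absolutely
    -- convergent integral; Fubini then moves it back onto `f`.
    have : T ψ = (𝓕 T) (𝓕⁻ ψ) := by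
      rw [TemperedDistribution.fourier_apply, fourier_fourierInv_eq]
    rw [this, hT, TemperedDistribution.smulLeftCLM_apply_apply,
      TemperedDistribution.fourier_apply, Lp.toTemperedDistribution_apply]
    simp only [fourier_symbol_fourierInv_apply c ht, smul_eq_mul, mul_comm (f _)]
  rw [← h1, h2]
  have hint : Integrable (Function.uncurry fun x y : E =>
      (f x * ψ y) * Complex.exp (‖x - y‖ ^ 2 / (4 * t) * Complex.I))
      ((volume : Measure E).prod volume) := by
    refine (hf.mul_prod ψ.integrable (ν := volume)).mono ?_ (Filter.Eventually.of_forall ?_)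
    · exact (hf.mul_prod ψ.integrable (ν := volume)).1.mul
        (Continuous.aestronglyMeasurable (by fun_prop))
    · rintro ⟨x, y⟩
      simp only [Function.uncurry_apply_pair]
      rw [norm_mul, show (‖x - y‖ ^ 2 / (4 * t) * Complex.I : ℂ)
        = ((‖x - y‖ ^ 2 / (4 * t) : ℝ) : ℂ) * Complex.I by push_cast; ring,
        Complex.norm_exp_ofReal_mul_I, mul_one]
  have e1 : ∀ x : E, f x * (schrodingerKernelConst n c t
        * ∫ y, ψ y * Complex.exp (‖x - y‖ ^ 2 / (4 * t) * Complex.I))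
      = schrodingerKernelConst n c t
        * ∫ y, (f x * ψ y) * Complex.exp (‖x - y‖ ^ 2 / (4 * t) * Complex.I) := by
    intro x
    rw [mul_left_comm, ← integral_const_mul]
    simp only [mul_assoc]
  simp only [e1]
  rw [integral_const_mul, integral_integral_swap hint, ← integral_const_mul]
  congr 1
  funext y
  rw [← integral_mul_cexp_norm_sub_sq ht, Complex.real_smul, ← hψφ y, mul_left_comm,
    ← integral_const_mul (ψ y)]
  congr 2
  funext x
  ring

theorem lintegral_smul_comp (F : E → ENNReal) (hF : Measurable F) {r : ℝ} (hr : r ≠ 0) :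
    ∫⁻ y, F (r • y) = ENNReal.ofReal |(r ^ n)⁻¹| * ∫⁻ ξ, F ξ := by
  have h := Measure.map_addHaar_smul (volume : Measure E) hr
  rw [finrank_euclideanSpace_fin] at h
  rw [← smul_eq_mul, ← lintegral_smul_measure, ← h, lintegral_map hF (by fun_prop)]

/-- Beurling's theorem for the Schrödinger evolution of an integrable function. -/
theorem ae_eq_zero_of_beurlingCondition_kernel [Nonempty (Fin n)] {t : ℝ} (ht : 0 < t) {C : ℂ}
    (hC : C ≠ 0) {f g : E → ℂ} (hf : Integrable f)
    (hg : g =ᵐ[volume] fun y => C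
      * (Complex.exp (‖y‖ ^ 2 / (4 * t) * Complex.I)
        * 𝓕 (gaussianModulation t f) ((4 * Real.pi * t)⁻¹ • y)))
    (hB : BeurlingCondition t f g) : f =ᵐ[volume] 0 := by
  have hpi := Real.pi_pos
  set h := gaussianModulation t f with hh
  have hhi : Integrable h := integrable_gaussianModulation t hf
  have hc := Real.continuous_fourier_of_integrable hhi
  have hr : (4 * Real.pi * t)⁻¹ ≠ 0 := by positivity
  have hkey : ∀ x : E, ∫⁻ y, ‖f x‖ₑ * ‖g y‖ₑ * ENNReal.ofReal (Real.exp (‖x‖ * ‖y‖ / (2 * t)))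
      = (‖C‖ₑ * ENNReal.ofReal |(((4 * Real.pi * t)⁻¹) ^ n)⁻¹|) * ∫⁻ ξ, ‖h x‖ₑ * ‖𝓕 h ξ‖ₑ
        * ENNReal.ofReal (Real.exp (2 * Real.pi * ‖x‖ * ‖ξ‖)) := by
    intro x
    have hm : Measurable fun ξ : E => ‖h x‖ₑ * ‖𝓕 h ξ‖ₑ
        * ENNReal.ofReal (Real.exp (2 * Real.pi * ‖x‖ * ‖ξ‖)) :=
      (hc.enorm.measurable.const_mul _).mul
        (ENNReal.continuous_ofReal.comp (by fun_prop)).measurable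
    rw [mul_assoc, ← lintegral_smul_comp _ hm hr, ← lintegral_const_mul' _ _ enorm_ne_top]
    refine lintegral_congr_ae ?_
    filter_upwards [hg] with y hy
    have e1 : ‖f x‖ₑ = ‖h x‖ₑ := by
      rw [← ofReal_norm, ← ofReal_norm, hh, norm_gaussianModulation]
    have e2 : ‖g y‖ₑ = ‖C‖ₑ * ‖𝓕 h ((4 * Real.pi * t)⁻¹ • y)‖ₑ := by
      rw [hy, enorm_mul, enorm_mul, ← ofReal_norm (Complex.exp _),
        show (‖y‖ ^ 2 / (4 * t) * Complex.I : ℂ) = ((‖y‖ ^ 2 / (4 * t) : ℝ) : ℂ) * Complex.I by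
        push_cast; ring, Complex.norm_exp_ofReal_mul_I, ENNReal.ofReal_one, one_mul]
    -- The weight `e^{|x||y|/(2t)}` is exactly the Beurling weight at `ξ = y / (4πt)`.
    have e3 : ‖x‖ * ‖y‖ / (2 * t) = 2 * Real.pi * ‖x‖ * ‖(4 * Real.pi * t)⁻¹ • y‖ := by
      rw [norm_smul, Real.norm_eq_abs, abs_of_pos (by positivity)]
      field_simp
      ring
    rw [e1, e2, e3]
    ring
  have hfin : ∫⁻ x, ∫⁻ ξ, ‖h x‖ₑ * ‖𝓕 h ξ‖ₑ
      * ENNReal.ofReal (Real.exp (2 * Real.pi * ‖x‖ * ‖ξ‖)) < ⊤ := by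
    have hB' := hB
    rw [BeurlingCondition] at hB'
    simp only [hkey] at hB'
    rw [lintegral_const_mul' _ _ (ENNReal.mul_ne_top enorm_ne_top ENNReal.ofReal_ne_top)] at hB'
    refine ENNReal.lt_top_of_mul_ne_top_right hB'.ne (mul_ne_zero (enorm_ne_zero.2 hC) ?_)
    exact (ENNReal.ofReal_pos.2 (abs_pos.2 (inv_ne_zero (pow_ne_zero _ hr)))).ne'
  have := ae_eq_zero_of_beurling hhi hfin
  filter_upwards [this] with x hx
  rw [Pi.zero_apply, ← norm_eq_zero, ← norm_gaussianModulation t f x, ← hh, hx]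
  simp

theorem eq_zero_of_satisfiesFourierEvolution_zero {c : ℝ} {u : ℝ → 𝓢'(E, ℂ)}
    (hu : SatisfiesFourierEvolution c 0 u) (t : ℝ) : u t = 0 := by
  have h := hu t
  rw [FourierTransform.fourier_zero, map_zero] at h
  have h2 : 𝓕⁻ (𝓕 (u t)) = u t := fourierInv_fourier_eq (u t)
  rw [← h2, h, FourierTransform.fourierInv_zero]

theorem eq_zero_of_satisfiesFourierEvolution [Nonempty (Fin n)] {c : ℝ}
    {f : Lp ℂ 1 (volume : Measure E)} {u : ℝ → 𝓢'(E, ℂ)}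
    (hu : SatisfiesFourierEvolution c (Lp.toTemperedDistribution f) u) {t : ℝ} (ht : 0 < t)
    {g : E → ℂ} (hg : IsRepresentedBy (u t) g) (hB : BeurlingCondition t f g) :
    f = 0 ∧ ∀ s, u s = 0 := by
  have hf : f = 0 := (Lp.eq_zero_iff_ae_eq_zero).2
    (ae_eq_zero_of_beurlingCondition_kernel ht (schrodingerKernelConst_ne_zero c ht)
      (L1.integrable_coeFn f) (ae_eq_kernel_of_isRepresentedBy ht f (hu t) hg) hB)
  refine ⟨hf, eq_zero_of_satisfiesFourierEvolution_zero (c := c) ?_⟩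
  have h0 : Lp.toTemperedDistribution f = 0 := by
    rw [hf, ← Lp.toTemperedDistributionCLM_apply, map_zero]
  rwa [h0] at hu

/-! ### Distributional solutions paired with test functions. -/

theorem intervalIntegral_clm_apply₂ {X Y Z : Type*} [NormedAddCommGroup X] [NormedSpace ℝ X]
    [NormedAddCommGroup Y] [NormedSpace ℝ Y] [NormedAddCommGroup Z] [NormedSpace ℝ Z]
    [CompleteSpace X] [CompleteSpace Z] (L : X →L[ℝ] Y →L[ℝ] Z) {u : ℝ → X} (hu : Continuous u)
    (w : Y) (s t : ℝ) : ∫ τ in s..t, L (u τ) w = L (∫ τ in s..t, u τ) w :=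
  (L.flip w).intervalIntegral_comp_comm (hu.intervalIntegrable s t)

/-- The bilinear pairing `∫ u w` on `L²`. -/
noncomputable def l2Pairing (n : ℕ) :
    Lp ℂ 2 (volume : Measure (EuclideanSpace ℝ (Fin n))) →L[ℝ]
      Lp ℂ 2 (volume : Measure (EuclideanSpace ℝ (Fin n))) →L[ℝ] ℂ :=
  (ContinuousLinearMap.mul ℝ ℂ).lpPairing volume 2 2

theorem l2Pairing_apply (u w : Lp ℂ 2 (volume : Measure E)) :
    l2Pairing n u w = ∫ x, u x * w x :=
  (ContinuousLinearMap.mul ℝ ℂ).lpPairing_eq_integral u w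

theorem l2Pairing_toLp (u : Lp ℂ 2 (volume : Measure E)) (ψ : 𝓢(E, ℂ)) :
    l2Pairing n u (ψ.toLp 2) = ∫ x, u x * ψ x := by
  rw [l2Pairing_apply]
  refine integral_congr_ae ?_
  filter_upwards [ψ.coeFn_toLp 2 volume] with x hx
  rw [hx]

theorem l2Pairing_toLp_eq_toTemperedDistribution (u : Lp ℂ 2 (volume : Measure E)) (ψ : 𝓢(E, ℂ)) :
    l2Pairing n u (ψ.toLp 2) = Lp.toTemperedDistribution u ψ := by
  rw [l2Pairing_toLp, Lp.toTemperedDistribution_apply]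
  simp only [smul_eq_mul, mul_comm]

theorem integrable_mul_schwartz (u : Lp ℂ 2 (volume : Measure E)) (ψ : 𝓢(E, ℂ)) :
    Integrable fun x => u x * ψ x :=
  (Lp.memLp u).integrable_mul (ψ.memLp 2)

namespace IsDampedSchrodingerSolution

/-- Testing with a product `χ(t) ψ(x)` separates time from space; pulling out `-i` leaves the weak
form of `∂ₜ⟨u, ψ⟩ = i⟨u, (Δ - c)ψ⟩`. -/
theorem integral_equation_tensor {c : ℝ} (u : Lp ℂ 2 (volume : Measure E)) {χ : ℝ → ℝ}
    (hχ : ContDiff ℝ ∞ χ) (ψ : 𝓢(E, ℂ)) (τ : ℝ) :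
    ∫ x : E, u x * (-Complex.I * deriv (fun s => (χ s : ℂ) * ψ x) τ
        + Δ (fun y => (χ τ : ℂ) * ψ y) x - c * ((χ τ : ℂ) * ψ x))
      = -Complex.I * ((deriv χ τ • ∫ x : E, u x * ψ x)
        + χ τ • (Complex.I * ∫ x : E, u x * (Δ ψ - (c : ℂ) • ψ : 𝓢(E, ℂ)) x)) := by
  have hderiv : ∀ x : E, deriv (fun s => (χ s : ℂ) * ψ x) τ = ((deriv χ τ : ℝ) : ℂ) * ψ x := by
    intro x
    have h1 : HasDerivAt χ (deriv χ τ) τ :=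
      (hχ.differentiable (by simp)).differentiableAt.hasDerivAt
    exact (h1.ofReal_comp.mul_const (ψ x)).deriv
  have hlap : ∀ x : E, Δ (fun y => (χ τ : ℂ) * ψ y) x = (χ τ : ℂ) * Δ (ψ : E → ℂ) x := by
    intro x
    exact InnerProductSpace.laplacian_smul (χ τ : ℂ) ((ψ.smooth 2).contDiffAt (x := x))
  have hpt : ∀ x : E, u x * (-Complex.I * deriv (fun s => (χ s : ℂ) * ψ x) τ
      + Δ (fun y => (χ τ : ℂ) * ψ y) x - c * ((χ τ : ℂ) * ψ x))
      = (-Complex.I * ((deriv χ τ : ℝ) : ℂ)) * (u x * ψ x)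
        + (χ τ : ℂ) * (u x * (Δ ψ - (c : ℂ) • ψ : 𝓢(E, ℂ)) x) := by
    intro x
    rw [hderiv, hlap, sub_apply, smul_apply, smul_eq_mul, SchwartzMap.laplacian_apply]
    ring
  simp only [hpt]
  rw [integral_add ((integrable_mul_schwartz u ψ).const_mul _)
    ((integrable_mul_schwartz u _).const_mul _), integral_const_mul, integral_const_mul,
    Complex.real_smul, Complex.real_smul]
  linear_combination
    ((χ τ : ℂ) * ∫ x, u x * (Δ ψ - (c : ℂ) • ψ : 𝓢(E, ℂ)) x) * Complex.I_mul_I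

theorem integral_tensor_eq_zero {c : ℝ} {f : Lp ℂ 2 (volume : Measure E)}
    {u : ℝ → Lp ℂ 2 (volume : Measure E)} (hu : IsDampedSchrodingerSolution c f u)
    (ψ : 𝓢(E, ℂ)) (hψ : HasCompactSupport ψ) {χ : ℝ → ℝ} (hχ : ContDiff ℝ ∞ χ)
    (hχc : HasCompactSupport χ) :
    ∫ τ, ((deriv χ τ • ∫ x : E, u τ x * ψ x)
        + χ τ • (Complex.I * ∫ x : E, u τ x * (Δ ψ - (c : ℂ) • ψ : 𝓢(E, ℂ)) x)) = 0 := by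
  have hsm : ContDiff ℝ ∞ fun p : ℝ × E => (χ p.1 : ℂ) * ψ p.2 := by
    have h1 : ContDiff ℝ ∞ fun p : ℝ × E => (χ p.1 : ℂ) :=
      Complex.ofRealCLM.contDiff.comp (hχ.comp contDiff_fst)
    exact h1.mul ((ψ.smooth ⊤).comp contDiff_snd)
  have hcs : HasCompactSupport fun p : ℝ × E => (χ p.1 : ℂ) * ψ p.2 := by
    refine HasCompactSupport.intro (hχc.isCompact.prod hψ.isCompact) fun p hp => ?_
    rw [Set.mem_prod, not_and_or] at hp
    rcases hp with hp | hp
    · rw [image_eq_zero_of_notMem_tsupport hp, Complex.ofReal_zero, zero_mul]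
    · rw [image_eq_zero_of_notMem_tsupport hp, mul_zero]
  have heq := hu.equation (fun p => (χ p.1 : ℂ) * ψ p.2) hsm hcs
  simp only [integral_equation_tensor _ hχ] at heq
  rw [integral_const_mul] at heq
  exact (mul_eq_zero.1 heq).resolve_left (neg_ne_zero.2 Complex.I_ne_zero)

theorem l2Pairing_sub_of_hasCompactSupport {c : ℝ} {f : Lp ℂ 2 (volume : Measure E)}
    {u : ℝ → Lp ℂ 2 (volume : Measure E)} (hu : IsDampedSchrodingerSolution c f u)
    (ψ : 𝓢(E, ℂ)) (hψ : HasCompactSupport ψ) (s t : ℝ) :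
    l2Pairing n (u t - u s) (ψ.toLp 2)
      = Complex.I * l2Pairing n (∫ τ in s..t, u τ) ((Δ ψ - (c : ℂ) • ψ).toLp 2) := by
  have hcont : ∀ w : Lp ℂ 2 (volume : Measure E), Continuous fun τ => l2Pairing n (u τ) w :=
    fun w => ((l2Pairing n).flip w).continuous.comp hu.continuous
  have hmain := sub_eq_intervalIntegral_of_weak_deriv (hcont (ψ.toLp 2))
    ((hcont ((Δ ψ - (c : ℂ) • ψ).toLp 2)).const_mul Complex.I)
    (fun χ hχ hχc => by
      simp only [l2Pairing_toLp]
      exact integral_tensor_eq_zero hu ψ hψ hχ hχc) s t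
  rw [intervalIntegral.integral_const_mul, intervalIntegral_clm_apply₂ _ hu.continuous] at hmain
  rw [map_sub]
  exact hmain

/-- Compact support must be dropped because the Fourier multiplier evolution of a test function is
in general only Schwartz. -/
theorem l2Pairing_sub {c : ℝ} {f : Lp ℂ 2 (volume : Measure E)}
    {u : ℝ → Lp ℂ 2 (volume : Measure E)} (hu : IsDampedSchrodingerSolution c f u)
    (ψ : 𝓢(E, ℂ)) (s t : ℝ) :
    l2Pairing n (u t - u s) (ψ.toLp 2)
      = Complex.I * l2Pairing n (∫ τ in s..t, u τ) ((Δ ψ - (c : ℂ) • ψ).toLp 2) := by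
  obtain ⟨B, hB, hBb⟩ := exists_memLp_bound_truncate ψ
  have h1 := tendsto_integral_mul_of_eventually_eq (Lp.memLp (u t - u s)) hB
    (w := fun k => truncate k ψ) (w' := ψ) (fun k => (truncate k ψ).continuous)
    (fun k x => (hBb k x).1) (fun x => (truncate_eventuallyEq ψ x).mono fun k hk => hk.eq_of_nhds)
  have h2 := tendsto_integral_mul_of_eventually_eq (Lp.memLp (∫ τ in s..t, u τ))
    (hB.add (hB.const_mul ‖(c : ℂ)‖))
    (w := fun k => (Δ (truncate k ψ) - (c : ℂ) • truncate k ψ : 𝓢(E, ℂ)))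
    (w' := (Δ ψ - (c : ℂ) • ψ : 𝓢(E, ℂ)))
    (fun k => SchwartzMap.continuous _)
    (fun k x => by
      rw [sub_apply, smul_apply]
      refine (norm_sub_le _ _).trans ?_
      rw [norm_smul]
      exact add_le_add (hBb k x).2 (mul_le_mul_of_nonneg_left (hBb k x).1 (norm_nonneg _)))
    (fun x => (truncate_eventuallyEq ψ x).mono fun k hk => by
      simp only [sub_apply, smul_apply, SchwartzMap.laplacian_apply]
      rw [hk.eq_of_nhds, (InnerProductSpace.laplacian_congr_nhds hk).eq_of_nhds])
  simp only [← l2Pairing_toLp] at h1 h2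
  refine tendsto_nhds_unique h1 ((h2.const_mul Complex.I).congr fun k => ?_)
  exact (hu.l2Pairing_sub_of_hasCompactSupport _ (hasCompactSupport_truncate k ψ) s t).symm

end IsDampedSchrodingerSolution

/-! ### The generator, and the evolution on the Fourier side. -/

/-- The symbol `-i(|2πξ|² + c)` of the generator of the damped Schrödinger group. -/
noncomputable def dampedSchrodingerGenerator (n : ℕ) (c : ℝ) (ξ : EuclideanSpace ℝ (Fin n)) : ℂ :=
  -Complex.I * ((((2 * Real.pi * ‖ξ‖) ^ 2 + c : ℝ)) : ℂ)

theorem hasTemperateGrowth_dampedSchrodingerGenerator (c : ℝ) :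
    (dampedSchrodingerGenerator n c).HasTemperateGrowth := by
  have h0 : Function.HasTemperateGrowth (fun ξ : E => ‖ξ‖ ^ 2) :=
    Function.hasTemperateGrowth_norm_sq _
  have h1 : Function.HasTemperateGrowth fun ξ : E => (((2 * Real.pi) ^ 2 * ‖ξ‖ ^ 2 + c : ℝ) : ℂ) :=
    Complex.ofRealCLM.hasTemperateGrowth.comp
      (((Function.HasTemperateGrowth.const _).mul h0).add (Function.HasTemperateGrowth.const _))
  have h2 := (Function.HasTemperateGrowth.const (-Complex.I)).mul h1
  have h3 : dampedSchrodingerGenerator n c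
      = fun ξ => -Complex.I * (((2 * Real.pi) ^ 2 * ‖ξ‖ ^ 2 + c : ℝ) : ℂ) := by
    funext ξ
    rw [dampedSchrodingerGenerator, mul_pow]
  rw [h3]
  exact h2

theorem norm_dampedSchrodingerSymbol_sub_le (c s t : ℝ) (ξ : E) :
    ‖dampedSchrodingerSymbol n c t ξ - dampedSchrodingerSymbol n c s ξ
        - (t - s) * (dampedSchrodingerSymbol n c s ξ * dampedSchrodingerGenerator n c ξ)‖
      ≤ 3 * (t - s) ^ 2 * ‖dampedSchrodingerGenerator n c ξ‖ ^ 2 := by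
  set q : ℝ := (2 * Real.pi * ‖ξ‖) ^ 2 + c with hq
  have h1 : dampedSchrodingerSymbol n c t ξ
      = dampedSchrodingerSymbol n c s ξ * Complex.exp (((-(q * (t - s)) : ℝ) : ℂ) * Complex.I) := by
    rw [dampedSchrodingerSymbol, dampedSchrodingerSymbol, ← Complex.exp_add, ← hq]
    congr 1
    push_cast
    ring
  have h2 : dampedSchrodingerSymbol n c t ξ - dampedSchrodingerSymbol n c s ξ
        - (t - s) * (dampedSchrodingerSymbol n c s ξ * dampedSchrodingerGenerator n c ξ)
      = dampedSchrodingerSymbol n c s ξ * (Complex.exp (((-(q * (t - s)) : ℝ) : ℂ) * Complex.I) - 1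
        - ((-(q * (t - s)) : ℝ) : ℂ) * Complex.I) := by
    rw [h1, dampedSchrodingerGenerator, ← hq]
    push_cast
    ring
  rw [h2, norm_mul, norm_dampedSchrodingerSymbol, one_mul]
  refine (Complex.norm_exp_mul_I_sub_one_sub_le _).trans (le_of_eq ?_)
  rw [dampedSchrodingerGenerator, ← hq, norm_mul, norm_neg, Complex.norm_I, one_mul,
    Complex.norm_real, Real.norm_eq_abs, sq_abs]
  ring

/-- Multiplication by the symbol is differentiable in time with values in `L²`. -/
theorem hasDerivAt_toLp_smulLeftCLM_symbol (c : ℝ) (ψ : 𝓢(E, ℂ)) (s : ℝ) :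
    HasDerivAt (fun t => (SchwartzMap.smulLeftCLM ℂ (dampedSchrodingerSymbol n c t) ψ).toLp 2
        (volume : Measure E))
      ((SchwartzMap.smulLeftCLM ℂ (dampedSchrodingerSymbol n c s)
        (SchwartzMap.smulLeftCLM ℂ (dampedSchrodingerGenerator n c) ψ)).toLp 2) s := by
  have hm := hasTemperateGrowth_dampedSchrodingerSymbol n c
  have hg := hasTemperateGrowth_dampedSchrodingerGenerator (n := n) c
  -- The Taylor remainder of the symbol is at most `3(t - s)²` times the squared modulus of the
  -- generator, so the `L²` norm of `ρ` controls it after multiplication by `ψ`.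
  set ρ := SchwartzMap.smulLeftCLM ℂ (dampedSchrodingerGenerator n c)
    (SchwartzMap.smulLeftCLM ℂ (dampedSchrodingerGenerator n c) ψ) with hρ
  rw [hasDerivAt_iff_isLittleO]
  refine Asymptotics.IsBigO.trans_isLittleO (g := fun t => (t - s) ^ 2) ?_ ?_
  · refine Asymptotics.IsBigO.of_bound (3 * ‖ρ.toLp 2 (volume : Measure E)‖)
      (Filter.Eventually.of_forall fun t => ?_)
    have hb : ‖(SchwartzMap.smulLeftCLM ℂ (dampedSchrodingerSymbol n c t) ψ
        - SchwartzMap.smulLeftCLM ℂ (dampedSchrodingerSymbol n c s) ψ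
        - (t - s) • SchwartzMap.smulLeftCLM ℂ (dampedSchrodingerSymbol n c s)
          (SchwartzMap.smulLeftCLM ℂ (dampedSchrodingerGenerator n c) ψ) : 𝓢(E, ℂ)).toLp 2
            (volume : Measure E)‖ ≤ 3 * (t - s) ^ 2 * ‖ρ.toLp 2 (volume : Measure E)‖ := by
      refine Lp.norm_le_mul_norm_of_ae_le_mul ?_
      filter_upwards [SchwartzMap.coeFn_toLp (SchwartzMap.smulLeftCLM ℂ
          (dampedSchrodingerSymbol n c t) ψ
        - SchwartzMap.smulLeftCLM ℂ (dampedSchrodingerSymbol n c s) ψ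
        - (t - s) • SchwartzMap.smulLeftCLM ℂ (dampedSchrodingerSymbol n c s)
          (SchwartzMap.smulLeftCLM ℂ (dampedSchrodingerGenerator n c) ψ)) 2 (volume : Measure E),
        ρ.coeFn_toLp 2 (volume : Measure E)] with ξ h1 h2
      rw [h1, h2, hρ]
      simp only [sub_apply, smul_apply, SchwartzMap.smulLeftCLM_apply_apply (hm _),
        SchwartzMap.smulLeftCLM_apply_apply hg, smul_eq_mul, Complex.real_smul]
      have h3 := mul_le_mul_of_nonneg_right (norm_dampedSchrodingerSymbol_sub_le c s t ξ)
        (norm_nonneg (ψ ξ))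
      rw [← norm_mul] at h3
      refine le_trans (le_of_eq ?_) (h3.trans (le_of_eq ?_))
      · congr 1
        push_cast
        ring
      · rw [norm_mul, norm_mul]
        ring
    refine le_trans (le_of_eq ?_) (hb.trans (le_of_eq ?_))
    · rfl
    · rw [norm_pow, Real.norm_eq_abs, sq_abs]
      ring
  · exact (Asymptotics.isLittleO_pow_sub_sub s one_lt_two).congr_left
      fun t => by rw [Real.norm_eq_abs, sq_abs]

theorem hasDerivAt_toLp_fourier_smulLeftCLM_symbol (c : ℝ) (ψ : 𝓢(E, ℂ)) (s : ℝ) :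
    HasDerivAt (fun t => (𝓕 (SchwartzMap.smulLeftCLM ℂ (dampedSchrodingerSymbol n c t) ψ)).toLp 2
        (volume : Measure E))
      ((𝓕 (SchwartzMap.smulLeftCLM ℂ (dampedSchrodingerSymbol n c s)
        (SchwartzMap.smulLeftCLM ℂ (dampedSchrodingerGenerator n c) ψ))).toLp 2) s := by
  simp only [← SchwartzMap.toLp_fourier_eq]
  exact ((Lp.fourierTransformₗᵢ E ℂ).toContinuousLinearEquiv.toContinuousLinearMap.restrictScalars
    ℝ).hasFDerivAt.comp_hasDerivAt s (hasDerivAt_toLp_smulLeftCLM_symbol c ψ s)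

theorem I_smul_laplacian_sub_fourier (c : ℝ) (φ : 𝓢(E, ℂ)) :
    Complex.I • (Δ (𝓕 φ) - (c : ℂ) • 𝓕 φ)
      = 𝓕 (SchwartzMap.smulLeftCLM ℂ (dampedSchrodingerGenerator n c) φ) := by
  have hsq : Function.HasTemperateGrowth (fun ξ : E => ‖ξ‖ ^ 2) :=
    Function.hasTemperateGrowth_norm_sq _
  have hlap : Δ (𝓕 φ) = -(2 * Real.pi) ^ 2 • 𝓕 (SchwartzMap.smulLeftCLM ℂ (‖·‖ ^ 2) φ) := by
    rw [SchwartzMap.laplacian_eq_fourierMultiplierCLM, SchwartzMap.fourierMultiplierCLM_apply]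
    congr 1
    ext ξ
    rw [SchwartzMap.fourierInv_coe, SchwartzMap.fourier_coe, Real.fourierInv_eq_fourier_comp_neg]
    refine congrArg (fun F : E → ℂ => 𝓕 F ξ) (funext fun x => ?_)
    have : 𝓕 (𝓕 φ) (-x) = φ x := by
      rw [SchwartzMap.fourier_coe, ← Real.fourierInv_eq_fourier_neg, ← SchwartzMap.fourierInv_coe,
        FourierTransform.fourierInv_fourier_eq]
    rw [SchwartzMap.smulLeftCLM_apply_apply hsq, SchwartzMap.smulLeftCLM_apply_apply hsq, this,
      norm_neg]
  have hgen : SchwartzMap.smulLeftCLM ℂ (dampedSchrodingerGenerator n c) φ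
      = Complex.I • (-(2 * Real.pi) ^ 2 • SchwartzMap.smulLeftCLM ℂ (‖·‖ ^ 2) φ
        - (c : ℂ) • φ) := by
    ext ξ
    simp only [smul_apply, sub_apply, SchwartzMap.smulLeftCLM_apply_apply hsq,
      SchwartzMap.smulLeftCLM_apply_apply (hasTemperateGrowth_dampedSchrodingerGenerator c),
      dampedSchrodingerGenerator, smul_eq_mul, Complex.real_smul]
    push_cast
    ring
  have hsub : ∀ a b : 𝓢(E, ℂ), 𝓕 (a - b) = 𝓕 a - 𝓕 b := fun a b =>
    map_sub (FourierTransform.fourierCLM ℂ 𝓢(E, ℂ)) a b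
  rw [hgen, hlap, FourierTransform.fourier_smul, hsub, FourierTransform.fourier_smul,
    FourierTransform.fourier_smul]

theorem dampedSchrodingerSymbol_zero (c : ℝ) : dampedSchrodingerSymbol n c 0 = fun _ => 1 := by
  funext ξ
  simp [dampedSchrodingerSymbol]

/-- Distributional solutions in `C(ℝ; L²)` solve the problem on the Fourier side. -/
theorem IsDampedSchrodingerSolution.satisfiesFourierEvolution {c : ℝ}
    {f : Lp ℂ 2 (volume : Measure E)} {u : ℝ → Lp ℂ 2 (volume : Measure E)}
    (hu : IsDampedSchrodingerSolution c f u) :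
    SatisfiesFourierEvolution c (Lp.toTemperedDistribution f)
      (fun t => Lp.toTemperedDistribution (u t)) := by
  intro t
  ext ψ
  have hm := hasTemperateGrowth_dampedSchrodingerSymbol n c
  have hg := hasTemperateGrowth_dampedSchrodingerGenerator (n := n) c
  have hcomm : ∀ s (φ : 𝓢(E, ℂ)), SchwartzMap.smulLeftCLM ℂ (dampedSchrodingerGenerator n c)
      (SchwartzMap.smulLeftCLM ℂ (dampedSchrodingerSymbol n c s) φ)
      = SchwartzMap.smulLeftCLM ℂ (dampedSchrodingerSymbol n c s)
        (SchwartzMap.smulLeftCLM ℂ (dampedSchrodingerGenerator n c) φ) := by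
    intro s φ
    rw [SchwartzMap.smulLeftCLM_smulLeftCLM_apply hg (hm s),
      SchwartzMap.smulLeftCLM_smulLeftCLM_apply (hm s) hg, mul_comm]
  -- The dual evolution is `v s = 𝓕 (mₛ ψ)`, with `mₛ` the symbol at time `s`. Each time derivative
  -- multiplies by the generator under `𝓕`, which by `I_smul_laplacian_sub_fourier` is `i(Δ - c)`
  -- outside it. Comparing `v 0` with `v t` is the asserted Fourier evolution tested on `ψ`.
  have hkey := pairing_eq_of_weak_evolution (l2Pairing n) hu.continuous
    (hasDerivAt_toLp_fourier_smulLeftCLM_symbol c ψ)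
    (hasDerivAt_toLp_fourier_smulLeftCLM_symbol c
      (SchwartzMap.smulLeftCLM ℂ (dampedSchrodingerGenerator n c) ψ))
    (fun r s t => by
      rw [hu.l2Pairing_sub, ← hcomm, ← I_smul_laplacian_sub_fourier, l2Pairing_toLp,
        l2Pairing_toLp, ← integral_const_mul]
      congr 1
      funext x
      rw [smul_apply, smul_eq_mul]
      ring) t
  rw [l2Pairing_toLp_eq_toTemperedDistribution, l2Pairing_toLp_eq_toTemperedDistribution,
    hu.initial, dampedSchrodingerSymbol_zero, SchwartzMap.smulLeftCLM_const, one_smul] at hkey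
  rw [TemperedDistribution.smulLeftCLM_apply_apply, TemperedDistribution.fourier_apply,
    TemperedDistribution.fourier_apply]
  exact hkey

/-! ### Reduction of part (a) to part (b). -/

/-- The weight is at least one, so `‖f‖₁ ‖g‖₁ < ∞`, and `‖g‖₁ ≠ 0` can be divided out. -/
theorem BeurlingCondition.integrable {t : ℝ} (ht : 0 < t) {f g : E → ℂ}
    (hf : AEStronglyMeasurable f) (hg : AEStronglyMeasurable g) (hg0 : ¬ g =ᵐ[volume] 0)
    (hB : BeurlingCondition t f g) : Integrable f := by
  refine ⟨hf, ?_⟩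
  have hg1 : ∫⁻ y, ‖g y‖ₑ ≠ 0 := by
    rw [Ne, lintegral_eq_zero_iff' hg.enorm]
    refine fun h => hg0 (h.mono fun y hy => ?_)
    simpa using hy
  have h1 : (∫⁻ x, ‖f x‖ₑ) * ∫⁻ y, ‖g y‖ₑ < ⊤ := by
    rw [← lintegral_mul_const'' _ hf.enorm]
    refine lt_of_le_of_lt (lintegral_mono fun x => ?_) hB
    rw [← lintegral_const_mul' _ _ enorm_ne_top]
    refine lintegral_mono fun y => le_mul_of_one_le_right' ?_
    rw [ENNReal.one_le_ofReal]
    exact Real.one_le_exp (by positivity)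
  exact ENNReal.lt_top_of_mul_ne_top_left h1.ne hg1

theorem eq_zero_of_toTemperedDistribution_eq_zero {v : Lp ℂ 2 (volume : Measure E)}
    (h : Lp.toTemperedDistribution v = 0) : v = 0 := by
  have hmem : v ∈ (Lp.toTemperedDistributionCLM ℂ (volume : Measure E) 2).ker := h
  rwa [Lp.ker_toTemperedDistributionCLM_eq_bot, Submodule.mem_bot] at hmem

/-- The symbols at times `t` and `-t` are inverse to each other, so the evolution can be undone. -/
theorem SatisfiesFourierEvolution.initial_eq_zero {c : ℝ} {T : 𝓢'(E, ℂ)} {u : ℝ → 𝓢'(E, ℂ)}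
    (hu : SatisfiesFourierEvolution c T u) {t : ℝ} (ht : u t = 0) : T = 0 := by
  have h := congrArg (TemperedDistribution.smulLeftCLM ℂ (dampedSchrodingerSymbol n c (-t))) (hu t)
  have hone : dampedSchrodingerSymbol n c t * dampedSchrodingerSymbol n c (-t) = fun _ => 1 := by
    funext ξ
    rw [Pi.mul_apply, dampedSchrodingerSymbol, dampedSchrodingerSymbol, ← Complex.exp_add,
      ← Complex.exp_zero]
    congr 1
    push_cast
    ring
  rw [ht, FourierTransform.fourier_zero, map_zero,
    TemperedDistribution.smulLeftCLM_smulLeftCLM_apply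
      (hasTemperateGrowth_dampedSchrodingerSymbol n c _)
      (hasTemperateGrowth_dampedSchrodingerSymbol n c _)] at h
  simp only [hone, TemperedDistribution.smulLeftCLM_const, one_smul] at h
  have h2 : 𝓕⁻ (𝓕 T) = T := fourierInv_fourier_eq T
  rw [← h2, ← h, FourierTransform.fourierInv_zero]

theorem isRepresentedBy_toTemperedDistribution (v : Lp ℂ 2 (volume : Measure E)) :
    IsRepresentedBy (Lp.toTemperedDistribution v) v :=
  ⟨(Lp.memLp v).locallyIntegrable one_le_two, fun φ _ => Lp.toTemperedDistribution_apply v φ⟩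

theorem IsDampedSchrodingerSolution.eq_zero [Nonempty (Fin n)] {c : ℝ}
    {f : Lp ℂ 2 (volume : Measure E)} {u : ℝ → Lp ℂ 2 (volume : Measure E)}
    (hu : IsDampedSchrodingerSolution c f u) {t : ℝ} (ht : 0 < t)
    (hB : BeurlingCondition t f (u t)) : f = 0 ∧ ∀ s, u s = 0 := by
  have hev := hu.satisfiesFourierEvolution
  have hT : Lp.toTemperedDistribution f = 0 := by
    -- When `u t = 0` the Beurling condition carries no information and `f` is recovered by evolving
    -- back. Otherwise the condition makes `f` integrable, and part (b) applies to its `L¹` class.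
    by_cases h0 : u t = 0
    · refine hev.initial_eq_zero (t := t) ?_
      simp only [h0]
      exact map_zero (Lp.toTemperedDistributionCLM ℂ (volume : Measure E) 2)
    · have hint : Integrable f := hB.integrable ht (Lp.aestronglyMeasurable f)
        (Lp.aestronglyMeasurable (u t)) fun h => h0 (Lp.eq_zero_iff_ae_eq_zero.2 h)
      have hcoe : hint.toL1 f =ᵐ[volume] f := hint.coeFn_toL1
      have heq : Lp.toTemperedDistribution (hint.toL1 f) = Lp.toTemperedDistribution f := by
        ext ψ
        rw [Lp.toTemperedDistribution_apply, Lp.toTemperedDistribution_apply]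
        refine integral_congr_ae ?_
        filter_upwards [hcoe] with x hx
        rw [hx]
      rw [← heq] at hev ⊢
      have hB' : BeurlingCondition t (hint.toL1 f) (u t) := by
        refine lt_of_le_of_lt (le_of_eq (lintegral_congr_ae ?_)) hB
        filter_upwards [hcoe] with x hx
        simp only [hx]
      rw [(eq_zero_of_satisfiesFourierEvolution hev ht
        (isRepresentedBy_toTemperedDistribution (u t)) hB').1]
      exact map_zero (Lp.toTemperedDistributionCLM ℂ (volume : Measure E) 1)
  rw [hT] at hev
  exact ⟨eq_zero_of_toTemperedDistribution_eq_zero hT, fun s =>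
    eq_zero_of_toTemperedDistribution_eq_zero (eq_zero_of_satisfiesFourierEvolution_zero hev s)⟩

end Schrodinger

theorem mainTheorem10 (n : ℕ) (hn : 1 ≤ n) (c : ℝ) :
    (∀ (f : Lp ℂ 2 (volume : Measure (EuclideanSpace ℝ (Fin n))))
        (u : ℝ → Lp ℂ 2 (volume : Measure (EuclideanSpace ℝ (Fin n)))),
        IsDampedSchrodingerSolution c f u →
        (∃ t₀ : ℝ, 0 < t₀ ∧ BeurlingCondition t₀ f (u t₀)) →
        f = 0 ∧ ∀ t : ℝ, u t = 0) ∧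
    (∀ (f : Lp ℂ 1 (volume : Measure (EuclideanSpace ℝ (Fin n))))
        (u : ℝ → 𝓢'(EuclideanSpace ℝ (Fin n), ℂ)),
        SatisfiesFourierEvolution c (Lp.toTemperedDistribution f) u →
        (∃ (t₀ : ℝ) (g : EuclideanSpace ℝ (Fin n) → ℂ), 0 < t₀ ∧ IsRepresentedBy (u t₀) g ∧
          BeurlingCondition t₀ f g) →
        f = 0 ∧ ∀ t : ℝ, u t = 0) := by
  have : Nonempty (Fin n) := ⟨⟨0, hn⟩⟩
  exact ⟨fun _ _ hu ⟨_, ht, hB⟩ => hu.eq_zero ht hB,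
    fun _ _ hu ⟨_, _, ht, hg, hB⟩ => eq_zero_of_satisfiesFourierEvolution hu ht hg hB⟩
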